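/- Let $k\ge 1$ be an integer, let $0<\underline E\le\overline E<\infty$, $\underline\Sigma>0$, $1<p<\infty$, $\overline L<\infty$, and let $\chi_4:(0,\infty)\to[0,\infty)$ satisfy $\chi_4(s)\to0$ as $s\to0$. Let $f$ be a probability density on $\mathbb R^k$ with finite fourth moment and $f\in L^p(\mathbb R^k)$, and put $$E=\int_{\mathbb R^k}f(v)|v|^2\,dv,\qquad \Sigma=\sqrt{\int_{\mathbb R^k}(|v|^2-E)^2f(v)\,dv}.$$ Assume that $$\underline E\le E\le\overline E,\qquad \Sigma\ge\underline\Sigma,\qquad \|f\|_{L^p}\le\overline L,\qquad \int_{|v|\ge 1/s}f(v)|v|^4\,dv\le\chi_4(s)\quad\text{for all } s>0.$$ For integers $m,n\ge1$ and reals $r,s>0$ let $$Z_m(f,r)=\int_{S^{km-1}(r)}f^{\otimes m}\,d\sigma^{km}_r,\qquad \gamma^{(n)}(r)=\frac{e^{-r^2/2}}{(2\pi)^{n/2}},\qquad \alpha_n(s)=s^{\frac n2-1}e^{-\frac s2},$$ where $\sigma^{n}_r$ is the uniform probability measure on the sphere $S^{n-1}(r)\subset\mathbb R^{n}$ of radius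 $r$ centred at the origin, and $f^{\otimes m}(v_1,\dots,v_m)=\prod_{j=1}^m f(v_j)$ for $(v_1,\dots,v_m)\in(\mathbb R^k)^m=\mathbb R^{km}$. **Theorem.** There are an integer $M$ and a function $\omega:\mathbb N\to\mathbb R$ with $\omega(m)\to0$ as $m\to\infty$, both depending only on $k,\underline E,\overline E,\underline\Sigma,p,\overline L$ and $\chi_4$, such that for every such $f$, every $m\ge M$ and every $r>0$, the function $f^{\otimes m}$ is $\sigma_r^{km}$-integrable and $$Z_m(f,r)=\frac{\sqrt{2k}}{\Sigma}\;\gamma^{(km)}(r)\;\frac{\alpha_{km}(km)}{\alpha_{km}(r^2)}\Bigl[e^{-\frac{(r^2-mE)^2}{2m\Sigma^2}}+\varepsilon\Bigr]\quad\text{with } |\varepsilon|\le\omega(m).$$ In particular, for every such $f$ and every $m\ge M$, $$Z_m(f,\sqrt{km})=\frac{\sqrt{2k}}{\Sigma}\;\gamma^{(km)}(\sqrt{km})\Bigl[e^{-\frac{m(k-E)^2}{2\Sigma^2}}+\varepsilon'\Bigr]\quad\text{with } |\varepsilon'|\le\omega(m).$$ -/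

import Mathlib

open MeasureTheory Filter Topology

namespace Kac

noncomputable section

/-- The uniform probability measure on the sphere of radius `r` centred at the origin of `E`, as a
measure on `E`: the surface measure of the unit sphere, normalised to total mass one and pushed
forward under `x ↦ r • x`. -/
def sphereUniform (E : Type*) [NormedAddCommGroup E] [InnerProductSpace ℝ E]
    [FiniteDimensional ℝ E] [MeasurableSpace E] [BorelSpace E] (r : ℝ) : Measure E :=
  (((volume : Measure E).toSphere Set.univ)⁻¹ • (volume : Measure E).toSphere).map
    (fun x : Metric.sphere (0 : E) 1 => r • (x : E))

/-- The `j`-th velocity `v_j ∈ ℝ^k` of a configuration `v = (v_1, …, v_m) ∈ ℝ^{km}`. -/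
def velocity {m k : ℕ} (v : EuclideanSpace ℝ (Fin m × Fin k)) (j : Fin m) :
    EuclideanSpace ℝ (Fin k) :=
  WithLp.toLp 2 (fun i => v (j, i))

/-- The tensor power `f^{⊗m}(v_1, …, v_m) = f(v_1) ⋯ f(v_m)` on `ℝ^{km}`. -/
def tensorPower {k : ℕ} (f : EuclideanSpace ℝ (Fin k) → ℝ) (m : ℕ)
    (v : EuclideanSpace ℝ (Fin m × Fin k)) : ℝ :=
  ∏ j : Fin m, f (velocity v j)

/-- `Z_m(f, r)`, the integral of `f^{⊗m}` against the uniform probability measure on the sphere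
`S^{km-1}(r)`. -/
def Z {k : ℕ} (f : EuclideanSpace ℝ (Fin k) → ℝ) (m : ℕ) (r : ℝ) : ℝ :=
  ∫ v, tensorPower f m v ∂(sphereUniform (EuclideanSpace ℝ (Fin m × Fin k)) r)

/-- The mean energy `E = ∫ |v|² f(v) dv`. -/
def energy {k : ℕ} (f : EuclideanSpace ℝ (Fin k) → ℝ) : ℝ :=
  ∫ v, ‖v‖ ^ 2 * f v

/-- The standard deviation `Σ = (∫ (|v|² - E)² f(v) dv)^{1/2}` of the energy. -/
def energyDev {k : ℕ} (f : EuclideanSpace ℝ (Fin k) → ℝ) : ℝ :=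
  Real.sqrt (∫ v, (‖v‖ ^ 2 - energy f) ^ 2 * f v)

/-- `f` is a probability density on `ℝ^k`. -/
structure IsProbDensity {k : ℕ} (f : EuclideanSpace ℝ (Fin k) → ℝ) : Prop where
  measurable : Measurable f
  nonneg : ∀ v, 0 ≤ f v
  lintegral_eq_one : ∫⁻ v, ENNReal.ofReal (f v) = 1

/-- `γ^{(n)}(r) = (2π)^{-n/2} e^{-r²/2}`, the value of the standard Gaussian density of `ℝ^n` on the
sphere of radius `r`. -/
def gaussianOnSphere (n : ℕ) (r : ℝ) : ℝ :=
  Real.exp (-(r ^ 2) / 2) / (2 * Real.pi) ^ ((n : ℝ) / 2)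

/-- `α_n(s) = s^{n/2 - 1} e^{-s/2}`. -/
def alpha (n : ℕ) (s : ℝ) : ℝ :=
  s ^ ((n : ℝ) / 2 - 1) * Real.exp (-s / 2)

end

end Kac

/-!
Write `u_m` for the density of the total energy `|v_1|² + ⋯ + |v_m|²` under `f^{⊗m}`. In polar
coordinates, `Z_m(f, r)` is an explicit Gamma factor times `u_m(r²)`, so Stirling's formula reduces
the theorem to a local central limit theorem for `u_m` that is uniform over the class. Energies of
independent particles add, so `u_m` is an `m`-fold convolution; defining radial densities by
integrals over spheres makes this an identity at every point, not merely almost everywhere.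

The local limit theorem combines Fourier inversion of `φ^m`, where `φ` is the characteristic
function of the energy of one particle, with three uniform estimates on `φ`.

* The `L^p` and energy bounds allow `f` to be truncated, at a small cost in mass, so that its energy
  density is bounded. Plancherel's identity then controls the measure of the level sets
  `{|φ| > ε}`, and some fixed power of `φ` is integrable with a uniform bound.
* This bound makes the set where `|φ|` is close to `1` small, while `1 - |φ(n t)| ≤ n² (1 - |φ(t)|)`
  would spread a value near `1` at `t` along the multiples of `t`. Hence `|φ| ≤ q < 1` away from
  `0`, uniformly over the class.
* Near `0` the uniform tail bound `χ_4` gives a uniform second-order Taylor expansion of `φ`, once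
  the energy is centred.
-/

namespace Kac

open scoped ENNReal NNReal FourierTransform

section RadialDensity

variable {E A B : Type*}
  [NormedAddCommGroup E] [InnerProductSpace ℝ E] [FiniteDimensional ℝ E] [MeasurableSpace E]
  [BorelSpace E]
  [NormedAddCommGroup A] [InnerProductSpace ℝ A] [FiniteDimensional ℝ A] [MeasurableSpace A]
  [BorelSpace A]
  [NormedAddCommGroup B] [InnerProductSpace ℝ B] [FiniteDimensional ℝ B] [MeasurableSpace B]
  [BorelSpace B]

/-- The density on `(0, ∞)`, extended by zero to `ℝ`, of the image under `z ↦ ‖z‖²` of the measure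
with density `F`. It is defined by integration over spheres, so that its value at every single
point is meaningful. -/
noncomputable def radialDensity (F : E → ℝ≥0∞) : ℝ → ℝ≥0∞ :=
  (Set.Ioi 0).indicator fun u =>
    ENNReal.ofReal (u ^ ((Module.finrank ℝ E : ℝ) / 2 - 1) / 2) *
      ∫⁻ ω, F (√u • (ω : E)) ∂(volume : Measure E).toSphere

lemma radialDensity_of_pos (F : E → ℝ≥0∞) {u : ℝ} (hu : 0 < u) :
    radialDensity F u = ENNReal.ofReal (u ^ ((Module.finrank ℝ E : ℝ) / 2 - 1) / 2) *
      ∫⁻ ω, F (√u • (ω : E)) ∂(volume : Measure E).toSphere :=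
  Set.indicator_of_mem (s := Set.Ioi (0 : ℝ)) hu _

lemma radialDensity_of_nonpos (F : E → ℝ≥0∞) {u : ℝ} (hu : u ≤ 0) : radialDensity F u = 0 :=
  Set.indicator_of_notMem (s := Set.Ioi (0 : ℝ)) (by simpa using hu) _

lemma measurable_radialDensity_uncurry {X : Type*} [MeasurableSpace X] {F : X → E → ℝ≥0∞}
    (hF : Measurable (Function.uncurry F)) :
    Measurable (Function.uncurry fun x => radialDensity (F x)) := by
  have hsphere : Measurable fun q : X × ℝ =>
      ∫⁻ ω, F q.1 (√q.2 • (ω : E)) ∂(volume : Measure E).toSphere :=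
    Measurable.lintegral_prod_right' (f := fun q : (X × ℝ) × Metric.sphere (0 : E) 1 =>
      F q.1.1 (√q.1.2 • (q.2 : E))) (by fun_prop)
  exact Measurable.indicator (s := {q : X × ℝ | 0 < q.2}) (Measurable.mul (by fun_prop) hsphere)
    (measurableSet_lt measurable_const measurable_snd)

@[fun_prop]
lemma measurable_radialDensity {F : E → ℝ≥0∞} (hF : Measurable F) :
    Measurable (radialDensity F) :=
  (measurable_radialDensity_uncurry (F := fun _ : Unit => F) (by fun_prop)).comp
    (measurable_const (a := ()).prodMk measurable_id)

lemma radialDensity_const_mul (c : ℝ≥0∞) {F : E → ℝ≥0∞} (hF : Measurable F) (u : ℝ) :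
    radialDensity (fun z => c * F z) u = c * radialDensity F u := by
  rcases le_or_gt u 0 with hu | hu
  · simp only [radialDensity_of_nonpos _ hu, mul_zero]
  · rw [radialDensity_of_pos _ hu, radialDensity_of_pos _ hu,
      lintegral_const_mul _ (by fun_prop), mul_left_comm]

lemma radialDensity_norm_sq (F : ℝ → E → ℝ≥0∞) (u : ℝ) :
    radialDensity (fun z => F (‖z‖ ^ 2) z) u = radialDensity (F u) u := by
  rcases le_or_gt u 0 with hu | hu
  · rw [radialDensity_of_nonpos _ hu, radialDensity_of_nonpos _ hu]
  · have hnorm (ω : Metric.sphere (0 : E) 1) : ‖√u • (ω : E)‖ ^ 2 = u := by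
      rw [norm_smul, norm_eq_of_mem_sphere, mul_one, Real.norm_of_nonneg (Real.sqrt_nonneg _),
        Real.sq_sqrt hu.le]
    simp only [radialDensity_of_pos _ hu, hnorm]

lemma radialDensity_smul (F : E → ℝ≥0∞) {c : ℝ} (hc : 0 < c) (u : ℝ) :
    radialDensity (fun z => F (√c • z)) u =
      ENNReal.ofReal (c ^ (1 - (Module.finrank ℝ E : ℝ) / 2)) * radialDensity F (c * u) := by
  rcases le_or_gt u 0 with hu | hu
  · rw [radialDensity_of_nonpos _ hu,
      radialDensity_of_nonpos _ (mul_nonpos_of_nonneg_of_nonpos hc.le hu), mul_zero]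
  · rw [radialDensity_of_pos _ hu, radialDensity_of_pos _ (by positivity), ← mul_assoc,
      ← ENNReal.ofReal_mul (by positivity)]
    simp_rw [smul_smul, ← Real.sqrt_mul hc.le]
    congr 2
    rw [Real.mul_rpow hc.le hu.le, mul_div_assoc, ← mul_assoc, ← Real.rpow_add hc]
    simp

lemma lintegral_eq_lintegral_Ioi_sphere [Nontrivial E] {F : E → ℝ≥0∞} (hF : Measurable F) :
    ∫⁻ z, F z = ∫⁻ r in Set.Ioi (0 : ℝ), ENNReal.ofReal (r ^ (Module.finrank ℝ E - 1)) *
      ∫⁻ ω, F (r • (ω : E)) ∂(volume : Measure E).toSphere := by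
  have hpolar : Measurable fun p : Metric.sphere (0 : E) 1 × Set.Ioi (0 : ℝ) =>
      F ((p.2 : ℝ) • (p.1 : E)) := hF.comp (by fun_prop)
  have hcompl : ∫⁻ z, F z = ∫⁻ z : ({0}ᶜ : Set E), F z ∂volume.comap Subtype.val := by
    rw [lintegral_subtype_comap (measurableSet_singleton (0 : E)).compl, restrict_compl_singleton]
  have hcoord (z : ({0}ᶜ : Set E)) : F z = F (((homeomorphUnitSphereProd E z).2 : ℝ) •
      ((homeomorphUnitSphereProd E z).1 : E)) := by
    have hz : ‖(z : E)‖ ≠ 0 := norm_ne_zero_iff.2 z.2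
    simp [smul_smul, hz]
  rw [hcompl, lintegral_congr hcoord,
    (volume : Measure E).measurePreserving_homeomorphUnitSphereProd.lintegral_comp hpolar,
    lintegral_prod_symm _ hpolar.aemeasurable, Measure.volumeIoiPow,
    lintegral_withDensity_eq_lintegral_mul _ (by fun_prop) hpolar.lintegral_prod_left']
  exact lintegral_subtype_comap measurableSet_Ioi
    (fun r : ℝ => ENNReal.ofReal (r ^ (Module.finrank ℝ E - 1)) *
      ∫⁻ ω, F (r • (ω : E)) ∂(volume : Measure E).toSphere)

lemma setLIntegral_Ioi_eq_setLIntegral_comp_sqrt (g : ℝ → ℝ≥0∞) :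
    ∫⁻ r in Set.Ioi (0 : ℝ), g r =
      ∫⁻ u in Set.Ioi (0 : ℝ), ENNReal.ofReal (1 / (2 * √u)) * g (√u) := by
  have himage : (fun u : ℝ => √u) '' Set.Ioi 0 = Set.Ioi 0 := by
    ext r
    exact ⟨fun ⟨_, hu, hr⟩ => hr ▸ Real.sqrt_pos.2 hu,
      fun hr => ⟨r ^ 2, Set.mem_Ioi.2 (pow_pos hr 2), Real.sqrt_sq (le_of_lt hr)⟩⟩
  conv_lhs => rw [← himage]
  rw [lintegral_image_eq_lintegral_abs_deriv_mul measurableSet_Ioi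
    (fun u hu => (Real.hasDerivAt_sqrt (ne_of_gt hu)).hasDerivWithinAt)
    (fun u hu v hv h => (Real.sqrt_inj (le_of_lt hu) (le_of_lt hv)).1 h)]
  refine setLIntegral_congr_fun measurableSet_Ioi fun u _ => ?_
  rw [abs_of_nonneg (by positivity)]

lemma lintegral_eq_lintegral_radialDensity [Nontrivial E] {F : E → ℝ≥0∞} (hF : Measurable F) :
    ∫⁻ z, F z = ∫⁻ u, radialDensity F u := by
  rw [lintegral_eq_lintegral_Ioi_sphere hF, setLIntegral_Ioi_eq_setLIntegral_comp_sqrt,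
    radialDensity, lintegral_indicator measurableSet_Ioi]
  refine setLIntegral_congr_fun measurableSet_Ioi fun u (hu : 0 < u) => ?_
  have hdim : 1 ≤ Module.finrank ℝ E := Module.finrank_pos
  have hpow : u ^ ((Module.finrank ℝ E : ℝ) / 2 - 1) = √u ^ (Module.finrank ℝ E - 1) / √u := by
    rw [Real.sqrt_eq_rpow, ← Real.rpow_mul_natCast hu.le, ← Real.rpow_sub hu, Nat.cast_sub hdim]
    congr 1
    push_cast
    ring
  rw [← mul_assoc, ← ENNReal.ofReal_mul (by positivity), hpow]
  congr 2
  field_simp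

/-- The weight `(s / τ)^(d / 2 - 1)` on the shell `1 < τ < 2`, where `τ = ‖z‖²` and `d` is the
dimension. Integrating `z ↦ K (√(s / ‖z‖²) • z)` against it over the shell gives the value at `s` of
`radialDensity K`; integrals over spheres thereby become integrals over the whole space. -/
noncomputable def shellWeight (d s : ℝ) : ℝ → ℝ≥0∞ :=
  (Set.Ioo 1 2).indicator fun τ => ENNReal.ofReal ((s / τ) ^ (d / 2 - 1))

@[fun_prop]
lemma measurable_shellWeight (d s : ℝ) : Measurable (shellWeight d s) :=
  Measurable.indicator (by fun_prop) measurableSet_Ioo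

lemma lintegral_indicator_Ioo_one_two (c : ℝ≥0∞) :
    ∫⁻ τ, (Set.Ioo (1 : ℝ) 2).indicator (fun _ => c) τ = c := by
  rw [lintegral_indicator_const measurableSet_Ioo, Real.volume_Ioo]
  norm_num

lemma lintegral_shell [Nontrivial E] {K : E → ℝ≥0∞} (hK : Measurable K) {s : ℝ} (hs : 0 < s) :
    ∫⁻ z, shellWeight (Module.finrank ℝ E) s (‖z‖ ^ 2) * K (√(s / ‖z‖ ^ 2) • z) =
      radialDensity K s := by
  rw [lintegral_eq_lintegral_radialDensity (by fun_prop),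
    ← lintegral_indicator_Ioo_one_two (radialDensity K s)]
  refine lintegral_congr fun τ => ?_
  rw [radialDensity_norm_sq (fun τ z => shellWeight (Module.finrank ℝ E) s τ * K (√(s / τ) • z)),
    radialDensity_const_mul _ (by fun_prop)]
  by_cases hτ : τ ∈ Set.Ioo (1 : ℝ) 2
  · have hτ0 : 0 < τ := one_pos.trans hτ.1
    have hc : 0 < s / τ := div_pos hs hτ0
    rw [radialDensity_smul K hc, shellWeight, Set.indicator_of_mem hτ, Set.indicator_of_mem hτ,
      div_mul_cancel₀ _ hτ0.ne', ← mul_assoc, ← ENNReal.ofReal_mul (by positivity),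
      ← Real.rpow_add hc]
    simp
  · simp only [shellWeight, Set.indicator_of_notMem hτ, zero_mul]

lemma radialDensity_comp_linearIsometryEquiv [Nontrivial A] (e : E ≃ₗᵢ[ℝ] A) {F : A → ℝ≥0∞}
    (hF : Measurable F) : radialDensity (fun z => F (e z)) = radialDensity F := by
  have : Nontrivial E := e.toEquiv.nontrivial
  funext s
  rcases le_or_gt s 0 with hs | hs
  · rw [radialDensity_of_nonpos _ hs, radialDensity_of_nonpos _ hs]
  · have hshell : Measurable fun z : A =>
        shellWeight (Module.finrank ℝ A) s (‖z‖ ^ 2) * F (√(s / ‖z‖ ^ 2) • z) := by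
      fun_prop
    rw [← lintegral_shell (by fun_prop) hs, ← lintegral_shell hF hs,
      ← e.measurePreserving.lintegral_comp hshell]
    simp only [e.norm_map, map_smul, e.toLinearEquiv.finrank_eq]

lemma lintegral_ofReal_abs_mul_comp_mul_left {g : ℝ → ℝ≥0∞} (hg : Measurable g) {c : ℝ}
    (hc : c ≠ 0) : ∫⁻ w, ENNReal.ofReal |c| * g (c * w) = ∫⁻ x, g x := by
  conv_rhs => rw [← Real.smul_map_volume_mul_left hc]
  rw [lintegral_smul_measure, lintegral_map hg (measurable_const_mul c),
    lintegral_const_mul _ (by fun_prop), smul_eq_mul]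

lemma lintegral_prod_eq_lintegral_radialDensity [Nontrivial A] [Nontrivial B]
    {F : ℝ → A → ℝ≥0∞} {G : ℝ → B → ℝ≥0∞}
    (hF : Measurable (Function.uncurry F)) (hG : Measurable (Function.uncurry G)) :
    ∫⁻ z : A × B, F (‖z.1‖ ^ 2 + ‖z.2‖ ^ 2) z.1 * G (‖z.1‖ ^ 2 + ‖z.2‖ ^ 2) z.2 =
      ∫⁻ τ, ∫⁻ w, radialDensity (F τ) (τ - w) * radialDensity (G τ) w := by
  have hF' (τ : ℝ) : Measurable (F τ) := hF.comp measurable_prodMk_left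
  have hG' (τ : ℝ) : Measurable (G τ) := hG.comp measurable_prodMk_left
  have hDF := measurable_radialDensity_uncurry hF
  have hDG := measurable_radialDensity_uncurry hG
  have hprod : Measurable fun z : A × B =>
      F (‖z.1‖ ^ 2 + ‖z.2‖ ^ 2) z.1 * G (‖z.1‖ ^ 2 + ‖z.2‖ ^ 2) z.2 := by
    fun_prop
  have hmixed : Measurable fun q : A × ℝ =>
      F (‖q.1‖ ^ 2 + q.2) q.1 * radialDensity (G (‖q.1‖ ^ 2 + q.2)) q.2 :=
    Measurable.mul (by fun_prop)
      (hDG.comp (f := fun q : A × ℝ => (‖q.1‖ ^ 2 + q.2, q.2)) (by fun_prop))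
  have hB (a : A) : ∫⁻ b, F (‖a‖ ^ 2 + ‖b‖ ^ 2) a * G (‖a‖ ^ 2 + ‖b‖ ^ 2) b =
      ∫⁻ w, F (‖a‖ ^ 2 + w) a * radialDensity (G (‖a‖ ^ 2 + w)) w := by
    rw [lintegral_eq_lintegral_radialDensity (by fun_prop)]
    refine lintegral_congr fun w => ?_
    rw [radialDensity_norm_sq (fun w b => F (‖a‖ ^ 2 + w) a * G (‖a‖ ^ 2 + w) b),
      radialDensity_const_mul _ (hG' _)]
  have hA (w : ℝ) : ∫⁻ a, F (‖a‖ ^ 2 + w) a * radialDensity (G (‖a‖ ^ 2 + w)) w =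
      ∫⁻ τ, radialDensity (F τ) (τ - w) * radialDensity (G τ) w := by
    refine (lintegral_eq_lintegral_radialDensity (hmixed.comp measurable_prodMk_right)).trans ?_
    rw [← lintegral_sub_right_eq_self _ w]
    refine lintegral_congr fun τ => ?_
    simp only [Function.comp_def, mul_comm _ (radialDensity (G _) w)]
    rw [radialDensity_norm_sq (fun u a => radialDensity (G (u + w)) w * F (u + w) a),
      radialDensity_const_mul _ (hF' _), sub_add_cancel]
  rw [Measure.volume_eq_prod, lintegral_prod _ hprod.aemeasurable, lintegral_congr hB,
    lintegral_lintegral_swap hmixed.aemeasurable, lintegral_congr hA, lintegral_lintegral_swap]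
  exact ((hDF.comp (f := fun q : ℝ × ℝ => (q.2, q.2 - q.1)) (by fun_prop)).mul
    (hDG.comp (f := fun q : ℝ × ℝ => (q.2, q.1)) (by fun_prop))).aemeasurable

lemma lintegral_prod_shell [Nontrivial A] [Nontrivial B] {F : A → ℝ≥0∞} {G : B → ℝ≥0∞}
    (hF : Measurable F) (hG : Measurable G) {s : ℝ} (hs : 0 < s) :
    ∫⁻ z : A × B, shellWeight (Module.finrank ℝ A + Module.finrank ℝ B) s
        (‖z.1‖ ^ 2 + ‖z.2‖ ^ 2) * F (√(s / (‖z.1‖ ^ 2 + ‖z.2‖ ^ 2)) • z.1) *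
          G (√(s / (‖z.1‖ ^ 2 + ‖z.2‖ ^ 2)) • z.2) =
      ∫⁻ x, radialDensity F (s - x) * radialDensity G x := by
  set d : ℝ := Module.finrank ℝ A + Module.finrank ℝ B with hd
  rw [lintegral_prod_eq_lintegral_radialDensity
      (F := fun τ a => shellWeight d s τ * F (√(s / τ) • a)) (G := fun τ b => G (√(s / τ) • b))
      (by fun_prop) (by fun_prop),
    ← lintegral_indicator_Ioo_one_two (∫⁻ x, radialDensity F (s - x) * radialDensity G x)]
  refine lintegral_congr fun τ => ?_
  simp_rw [radialDensity_const_mul (shellWeight d s τ)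
    (show Measurable fun a => F (√(s / τ) • a) by fun_prop)]
  by_cases hτ : τ ∈ Set.Ioo (1 : ℝ) 2
  · have hτ0 : 0 < τ := one_pos.trans hτ.1
    have hc : 0 < s / τ := div_pos hs hτ0
    have hexp : d / 2 - 1 + (1 - (Module.finrank ℝ A : ℝ) / 2) +
        (1 - (Module.finrank ℝ B : ℝ) / 2) = 1 := by rw [hd]; ring
    have hfactor : ENNReal.ofReal ((s / τ) ^ (d / 2 - 1)) *
        ENNReal.ofReal ((s / τ) ^ (1 - (Module.finrank ℝ A : ℝ) / 2)) *
        ENNReal.ofReal ((s / τ) ^ (1 - (Module.finrank ℝ B : ℝ) / 2)) =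
          ENNReal.ofReal (s / τ) := by
      rw [← ENNReal.ofReal_mul (by positivity), ← ENNReal.ofReal_mul (by positivity),
        ← Real.rpow_add hc, ← Real.rpow_add hc, hexp, Real.rpow_one]
    rw [shellWeight, Set.indicator_of_mem hτ, Set.indicator_of_mem hτ,
      ← lintegral_ofReal_abs_mul_comp_mul_left
        (g := fun x => radialDensity F (s - x) * radialDensity G x) (by fun_prop) hc.ne',
      abs_of_pos hc]
    refine lintegral_congr fun w => ?_
    rw [radialDensity_smul F hc, radialDensity_smul G hc, mul_sub, div_mul_cancel₀ _ hτ0.ne',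
      ← hfactor]
    ring
  · simp only [shellWeight, Set.indicator_of_notMem hτ, zero_mul, lintegral_zero]

lemma lintegral_radialDensity_mul_eq_zero (F : A → ℝ≥0∞) (G : B → ℝ≥0∞) {s : ℝ} (hs : s ≤ 0) :
    ∫⁻ x, radialDensity F (s - x) * radialDensity G x = 0 := by
  have hzero (x : ℝ) : radialDensity F (s - x) * radialDensity G x = 0 := by
    rcases le_or_gt x 0 with hx | hx
    · rw [radialDensity_of_nonpos G hx, mul_zero]
    · rw [radialDensity_of_nonpos F (by linarith), zero_mul]
  simp only [hzero, lintegral_zero]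

theorem radialDensity_tensor [Nontrivial A] [Nontrivial B] (e : E ≃ₗᵢ[ℝ] WithLp 2 (A × B))
    {F : A → ℝ≥0∞} {G : B → ℝ≥0∞} (hF : Measurable F) (hG : Measurable G) :
    radialDensity (fun z => F (e z).fst * G (e z).snd) =
      lconvolution (radialDensity F) (radialDensity G) volume := by
  have hFG : Measurable fun z : WithLp 2 (A × B) => F z.fst * G z.snd := by
    fun_prop
  rw [radialDensity_comp_linearIsometryEquiv e hFG]
  funext s
  rw [lconvolution_comm, lconvolution_def]
  simp_rw [neg_add_eq_sub, mul_comm (radialDensity G _)]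
  rcases le_or_gt s 0 with hs | hs
  · rw [radialDensity_of_nonpos _ hs, lintegral_radialDensity_mul_eq_zero F G hs]
  · have hdim : (Module.finrank ℝ (WithLp 2 (A × B)) : ℝ) =
        Module.finrank ℝ A + Module.finrank ℝ B := by
      rw [(WithLp.linearEquiv 2 ℝ (A × B)).finrank_eq, Module.finrank_prod, Nat.cast_add]
    rw [← lintegral_shell hFG hs, ← lintegral_prod_shell hF hG hs,
      ← (WithLp.volume_preserving_ofLp A B).lintegral_comp_emb
        (MeasurableEquiv.toLp 2 (A × B)).symm.measurableEmbedding]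
    refine lintegral_congr fun z => ?_
    rw [WithLp.prod_norm_sq_eq_of_L2, hdim, mul_assoc]
    rfl

end RadialDensity

section Configurations

/-- The index bijection separating the first of `m + 1` velocities from the others. -/
def splitIndex (m k : ℕ) : Fin (m + 1) × Fin k ≃ Fin k ⊕ Fin m × Fin k where
  toFun p := Fin.cases (motive := fun _ => Fin k ⊕ Fin m × Fin k) (Sum.inl p.2)
    (fun j => Sum.inr (j, p.2)) p.1
  invFun := Sum.elim (fun i => (0, i)) (fun q => (q.1.succ, q.2))
  left_inv := by
    rintro ⟨j, i⟩
    refine Fin.cases ?_ (fun j => ?_) j <;> simp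
  right_inv := by
    rintro (i | ⟨j, i⟩) <;> simp

/-- The isometry separating the first of `m + 1` velocities from the others. -/
noncomputable def splitVelocity (m k : ℕ) : EuclideanSpace ℝ (Fin (m + 1) × Fin k) ≃ₗᵢ[ℝ]
    WithLp 2 (EuclideanSpace ℝ (Fin k) × EuclideanSpace ℝ (Fin m × Fin k)) :=
  (LinearIsometryEquiv.piLpCongrLeft 2 ℝ ℝ (splitIndex m k)).trans
    (PiLp.sumPiLpEquivProdLpPiLp 2 (fun _ : Fin k ⊕ Fin m × Fin k => ℝ))

lemma splitVelocity_fst (m k : ℕ) (z : EuclideanSpace ℝ (Fin (m + 1) × Fin k)) :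
    (splitVelocity m k z).fst = velocity z 0 := by
  ext i
  rfl

lemma velocity_splitVelocity_snd (m k : ℕ) (z : EuclideanSpace ℝ (Fin (m + 1) × Fin k))
    (j : Fin m) : velocity (splitVelocity m k z).snd j = velocity z j.succ := by
  ext i
  rfl

/-- A configuration of one velocity is that velocity. -/
noncomputable def singleVelocity (k : ℕ) :
    EuclideanSpace ℝ (Fin 1 × Fin k) ≃ₗᵢ[ℝ] EuclideanSpace ℝ (Fin k) :=
  LinearIsometryEquiv.piLpCongrLeft 2 ℝ ℝ (Equiv.uniqueProd (Fin k) (Fin 1))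

lemma singleVelocity_apply (k : ℕ) (z : EuclideanSpace ℝ (Fin 1 × Fin k)) :
    singleVelocity k z = velocity z 0 := by
  ext i
  rfl

lemma measurable_velocity {m k : ℕ} (j : Fin m) :
    Measurable fun v : EuclideanSpace ℝ (Fin m × Fin k) => velocity v j := by
  unfold velocity
  fun_prop

end Configurations

section EnergyDensity

variable {E : Type*} [NormedAddCommGroup E] [InnerProductSpace ℝ E] [FiniteDimensional ℝ E]
  [MeasurableSpace E] [BorelSpace E]

/-- The density of `‖v‖²` under the density `f`. -/
noncomputable def energyDensity (f : E → ℝ) : ℝ → ℝ≥0∞ :=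
  radialDensity fun v => ENNReal.ofReal (f v)

@[fun_prop]
lemma measurable_energyDensity {f : E → ℝ} (hf : Measurable f) : Measurable (energyDensity f) :=
  measurable_radialDensity hf.ennreal_ofReal

lemma lintegral_energyDensity [Nontrivial E] {f : E → ℝ} (hf : Measurable f) :
    ∫⁻ u, energyDensity f u = ∫⁻ v, ENNReal.ofReal (f v) :=
  (lintegral_eq_lintegral_radialDensity hf.ennreal_ofReal).symm

variable {k : ℕ} {f : EuclideanSpace ℝ (Fin k) → ℝ}

lemma measurable_tensorPower (hf : Measurable f) (m : ℕ) : Measurable (tensorPower f m) :=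
  Finset.measurable_prod _ fun j _ => hf.comp (measurable_velocity j)

lemma tensorPower_nonneg (hf : ∀ v, 0 ≤ f v) (m : ℕ) (v : EuclideanSpace ℝ (Fin m × Fin k)) :
    0 ≤ tensorPower f m v :=
  Finset.prod_nonneg fun _ _ => hf _

/-- The density of `|v_1|² + ⋯ + |v_m|²` under `f^{⊗m}`. -/
noncomputable def totalEnergyDensity (f : EuclideanSpace ℝ (Fin k) → ℝ) (m : ℕ) : ℝ → ℝ≥0∞ :=
  energyDensity (tensorPower f m)

lemma measurable_totalEnergyDensity (hf : Measurable f) (m : ℕ) :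
    Measurable (totalEnergyDensity f m) :=
  measurable_energyDensity (measurable_tensorPower hf m)

variable [NeZero k]

lemma totalEnergyDensity_one (hf : Measurable f) : totalEnergyDensity f 1 = energyDensity f := by
  rw [energyDensity, ← radialDensity_comp_linearIsometryEquiv (singleVelocity k) hf.ennreal_ofReal]
  simp [totalEnergyDensity, energyDensity, tensorPower, singleVelocity_apply]

lemma totalEnergyDensity_succ (hf : Measurable f) (hf0 : ∀ v, 0 ≤ f v) (m : ℕ) [NeZero m] :
    totalEnergyDensity f (m + 1) =
      lconvolution (energyDensity f) (totalEnergyDensity f m) volume := by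
  simp only [totalEnergyDensity, energyDensity]
  rw [← radialDensity_tensor (splitVelocity m k) hf.ennreal_ofReal
      (measurable_tensorPower hf m).ennreal_ofReal]
  congr 1
  funext z
  rw [← ENNReal.ofReal_mul (hf0 _), splitVelocity_fst]
  simp only [tensorPower, Fin.prod_univ_succ, velocity_splitVelocity_snd]

end EnergyDensity

section SphereIntegral

lemma toSphere_univ_eq {ι : Type*} [Fintype ι] [Nonempty ι] :
    (volume : Measure (EuclideanSpace ℝ ι)).toSphere Set.univ =
      ENNReal.ofReal (2 * Real.pi ^ ((Fintype.card ι : ℝ) / 2) /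
        Real.Gamma ((Fintype.card ι : ℝ) / 2)) := by
  have hn : (0 : ℝ) < Fintype.card ι := by exact_mod_cast Fintype.card_pos
  rw [Measure.toSphere_apply_univ, EuclideanSpace.volume_ball, finrank_euclideanSpace,
    ENNReal.ofReal_one, one_pow, one_mul, ← ENNReal.ofReal_natCast,
    ← ENNReal.ofReal_mul hn.le, Real.Gamma_add_one (by positivity), Real.sqrt_eq_rpow,
    ← Real.rpow_mul_natCast Real.pi_pos.le]
  congr 1
  have : Real.Gamma ((Fintype.card ι : ℝ) / 2) ≠ 0 := (Real.Gamma_pos_of_pos (by positivity)).ne'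
  field_simp

lemma lintegral_sphereUniform {ι : Type*} [Fintype ι] [Nonempty ι]
    {F : EuclideanSpace ℝ ι → ℝ≥0∞} (hF : Measurable F) {r : ℝ} (hr : 0 < r) :
    ∫⁻ v, F v ∂(sphereUniform (EuclideanSpace ℝ ι) r) =
      radialDensity F (r ^ 2) * ENNReal.ofReal (Real.Gamma ((Fintype.card ι : ℝ) / 2) /
        (Real.pi ^ ((Fintype.card ι : ℝ) / 2) * (r ^ 2) ^ ((Fintype.card ι : ℝ) / 2 - 1))) := by
  rw [sphereUniform, lintegral_map hF (by fun_prop), lintegral_smul_measure,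
    radialDensity_of_pos _ (by positivity), Real.sqrt_sq hr.le, toSphere_univ_eq,
    finrank_euclideanSpace, ← ENNReal.ofReal_inv_of_pos (by positivity), smul_eq_mul,
    mul_right_comm, ← ENNReal.ofReal_mul (by positivity)]
  congr 2
  have : 0 < (r ^ 2) ^ ((Fintype.card ι : ℝ) / 2 - 1) := by positivity
  field_simp

variable {k : ℕ} [NeZero k] {f : EuclideanSpace ℝ (Fin k) → ℝ}

lemma Z_eq_totalEnergyDensity_mul (hf : Measurable f) (hf0 : ∀ v, 0 ≤ f v) (m : ℕ) [NeZero m]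
    {r : ℝ} (hr : 0 < r) :
    Z f m r = (totalEnergyDensity f m (r ^ 2)).toReal * (Real.Gamma (((k * m : ℕ) : ℝ) / 2) /
      (Real.pi ^ (((k * m : ℕ) : ℝ) / 2) * (r ^ 2) ^ (((k * m : ℕ) : ℝ) / 2 - 1))) := by
  rw [Z, integral_eq_lintegral_of_nonneg_ae (.of_forall (tensorPower_nonneg hf0 m))
    (measurable_tensorPower hf m).aestronglyMeasurable,
    lintegral_sphereUniform (measurable_tensorPower hf m).ennreal_ofReal hr, ENNReal.toReal_mul,
    ENNReal.toReal_ofReal (by positivity)]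
  simp [totalEnergyDensity, energyDensity, mul_comm]

lemma integrable_tensorPower (hf : Measurable f) (hf0 : ∀ v, 0 ≤ f v) (m : ℕ) [NeZero m]
    {r : ℝ} (hr : 0 < r) (h : totalEnergyDensity f m (r ^ 2) ≠ ∞) :
    Integrable (tensorPower f m) (sphereUniform (EuclideanSpace ℝ (Fin m × Fin k)) r) := by
  refine ⟨(measurable_tensorPower hf m).aestronglyMeasurable, ?_⟩
  rw [hasFiniteIntegral_iff_ofReal (.of_forall (tensorPower_nonneg hf0 m)),
    lintegral_sphereUniform (measurable_tensorPower hf m).ennreal_ofReal hr]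
  exact ENNReal.mul_lt_top h.lt_top ENNReal.ofReal_lt_top

end SphereIntegral

section Fourier

section Plancherel

open scoped ContDiff SchwartzMap

variable {V F : Type*} [NormedAddCommGroup V] [InnerProductSpace ℝ V] [FiniteDimensional ℝ V]
  [MeasurableSpace V] [BorelSpace V] [NormedAddCommGroup F]

lemma ae_eq_of_integral_schwartzMap_smul_eq [NormedSpace ℂ F] [CompleteSpace F] {g h : V → F}
    (hg : LocallyIntegrable g) (hh : LocallyIntegrable h)
    (H : ∀ Θ : 𝓢(V, ℂ), ∫ x, Θ x • g x = ∫ x, Θ x • h x) : g =ᵐ[volume] h := by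
  refine ae_eq_of_integral_contDiff_smul_eq hg hh fun θ hθ hθc => ?_
  have hΘc : HasCompactSupport fun x => (θ x : ℂ) := hθc.comp_left Complex.ofReal_zero
  have hΘ : ContDiff ℝ ∞ fun x => (θ x : ℂ) := Complex.ofRealCLM.contDiff.comp hθ
  simpa using H (hΘc.toSchwartzMap hΘ)

lemma integral_schwartzMap_smul_fourier [NormedSpace ℂ F] [CompleteSpace F] (Θ : 𝓢(V, ℂ))
    {g : V → F} (hg : Integrable g) :
    ∫ x, Θ x • 𝓕 g x = ∫ x, (𝓕 Θ : 𝓢(V, ℂ)) x • g x := by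
  have hflip := VectorFourier.integral_fourierIntegral_smul_eq_flip (L := innerₗ V)
    (μ := volume) (ν := volume) (f := Θ) (g := g) Real.continuous_fourierChar continuous_inner
    Θ.integrable hg
  rw [flip_innerₗ] at hflip
  exact hflip.symm

lemma integral_schwartzMap_smul_fourierInv [NormedSpace ℂ F] [CompleteSpace F] (Θ : 𝓢(V, ℂ))
    {g : V → F} (hg : Integrable g) :
    ∫ x, Θ x • 𝓕⁻ g x = ∫ x, (𝓕⁻ Θ : 𝓢(V, ℂ)) x • g x := by
  have hflip := VectorFourier.integral_fourierIntegral_smul_eq_flip (L := -innerₗ V)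
    (μ := volume) (ν := volume) (f := Θ) (g := g) Real.continuous_fourierChar
    (by exact (continuous_inner (𝕜 := ℝ)).neg) Θ.integrable hg
  rw [show (-innerₗ V).flip = -innerₗ V by ext; simp [real_inner_comm]] at hflip
  rw [SchwartzMap.fourierInv_coe]
  exact hflip.symm

lemma ae_eq_fourierInv_fourier [NormedSpace ℂ F] [CompleteSpace F] {g : V → F}
    (hg : Integrable g) (hg' : Integrable (𝓕 g)) : g =ᵐ[volume] 𝓕⁻ (𝓕 g) := by
  have hcont : Continuous (𝓕⁻ (𝓕 g)) :=
    VectorFourier.fourierIntegral_continuous Real.continuous_fourierChar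
      (by exact (continuous_inner (𝕜 := ℝ)).neg) hg'
  refine ae_eq_of_integral_schwartzMap_smul_eq hg.locallyIntegrable hcont.locallyIntegrable
    fun Θ => ?_
  rw [integral_schwartzMap_smul_fourierInv Θ hg', integral_schwartzMap_smul_fourier _ hg,
    FourierTransform.fourier_fourierInv_eq]

lemma fourier_toLp_ae_eq [InnerProductSpace ℂ F] [CompleteSpace F] {g : V → F}
    (hg : Integrable g) (hg2 : MemLp g 2) : (𝓕 (hg2.toLp g) : Lp F 2) =ᵐ[volume] 𝓕 g := by
  have hcont : Continuous (𝓕 g) :=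
    VectorFourier.fourierIntegral_continuous Real.continuous_fourierChar
      (by exact continuous_inner (𝕜 := ℝ)) hg
  refine ae_eq_of_integral_schwartzMap_smul_eq ((Lp.memLp _).locallyIntegrable one_le_two)
    hcont.locallyIntegrable fun Θ => ?_
  rw [integral_schwartzMap_smul_fourier Θ hg, ← Lp.toTemperedDistribution_apply,
    ← Lp.fourier_toTemperedDistribution_eq, TemperedDistribution.fourier_apply,
    Lp.toTemperedDistribution_apply]
  refine integral_congr_ae (hg2.coeFn_toLp.mono fun x hx => ?_)
  simp only [hx]

lemma eLpNorm_fourier_eq [InnerProductSpace ℂ F] [CompleteSpace F] {g : V → F}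
    (hg : Integrable g) (hg2 : MemLp g 2) : eLpNorm (𝓕 g) 2 volume = eLpNorm g 2 volume := by
  rw [← eLpNorm_congr_ae (fourier_toLp_ae_eq hg hg2), ← Lp.enorm_def, ← Lp.enorm_toLp hg2]
  rw [enorm_eq_iff_norm_eq, Lp.norm_fourier_eq]

end Plancherel

/-- The inversion integral `(2π)⁻¹ ∫ e^{-its} ψ(t) dt`, which recovers a density on `ℝ` from its
characteristic function `ψ`. -/
noncomputable def inversionIntegral (ψ : ℝ → ℂ) (s : ℝ) : ℂ :=
  (2 * Real.pi : ℂ)⁻¹ * ∫ t : ℝ, Complex.exp (-(t * s * Complex.I)) * ψ t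

lemma norm_exp_neg_mul_I (t s : ℝ) : ‖Complex.exp (-(t * s * Complex.I))‖ = 1 := by
  rw [Complex.norm_exp]
  simp

lemma continuous_inversionIntegral {ψ : ℝ → ℂ} (hψ : Integrable ψ) :
    Continuous (inversionIntegral ψ) := by
  refine continuous_const.mul (continuous_of_dominated (bound := fun t => ‖ψ t‖)
    (fun s => ?_) (fun s => ?_) hψ.norm (.of_forall fun t => by fun_prop))
  · have hexp : Continuous fun t : ℝ => Complex.exp (-(t * s * Complex.I)) := by fun_prop
    exact hexp.aestronglyMeasurable.mul hψ.1
  · refine .of_forall fun t => ?_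
    rw [norm_mul, norm_exp_neg_mul_I, one_mul]

lemma norm_inversionIntegral_le (ψ : ℝ → ℂ) (s : ℝ) :
    ‖inversionIntegral ψ s‖ ≤ (2 * Real.pi)⁻¹ * ∫ t, ‖ψ t‖ := by
  have hconst : ‖(2 * Real.pi : ℂ)⁻¹‖ = (2 * Real.pi)⁻¹ := by
    simp [abs_of_pos Real.pi_pos]
  rw [inversionIntegral, norm_mul, hconst]
  gcongr
  refine (norm_integral_le_integral_norm _).trans_eq ?_
  simp only [norm_mul, norm_exp_neg_mul_I, one_mul]

lemma inversionIntegral_eq_fourierInv (ψ : ℝ → ℂ) (s : ℝ) :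
    inversionIntegral ψ s = 𝓕⁻ (fun w => ψ (-(2 * Real.pi) * w)) s := by
  have hscale := Measure.integral_comp_mul_left
    (fun t : ℝ => Complex.exp (-(t * s * Complex.I)) * ψ t) (-(2 * Real.pi))
  rw [abs_inv, abs_neg, abs_of_pos (by positivity : 0 < 2 * Real.pi), Complex.real_smul] at hscale
  push_cast at hscale
  rw [Real.fourierInv_eq', inversionIntegral, ← hscale]
  refine integral_congr_ae (.of_forall fun w => ?_)
  simp only [smul_eq_mul, RCLike.inner_apply, conj_trivial]
  congr 2
  push_cast
  ring

lemma fourier_toReal_eq_charFun_withDensity {D : ℝ → ℝ≥0∞} (hD : Measurable D)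
    (hlt : ∀ᵐ x, D x < ∞) :
    𝓕 (fun x => ((D x).toReal : ℂ)) =
      fun w => charFun (volume.withDensity D) (-(2 * Real.pi) * w) := by
  funext w
  rw [Real.fourier_real_eq_integral_exp_smul, charFun_apply_real,
    integral_withDensity_eq_integral_toReal_smul hD hlt]
  refine integral_congr_ae (.of_forall fun x => ?_)
  simp only [smul_eq_mul, Complex.real_smul]
  rw [mul_comm]
  congr 2
  push_cast
  ring

lemma toReal_ae_eq_inversionIntegral {D : ℝ → ℝ≥0∞} (hD : Measurable D)
    (hfin : ∫⁻ x, D x ≠ ∞) (hint : Integrable (charFun (volume.withDensity D))) :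
    ∀ᵐ x, ((D x).toReal : ℂ) = inversionIntegral (charFun (volume.withDensity D)) x := by
  have hfourier := fourier_toReal_eq_charFun_withDensity hD (ae_lt_top hD hfin)
  have hfourier_int : Integrable (𝓕 fun x => ((D x).toReal : ℂ)) := by
    rw [hfourier]
    exact hint.comp_mul_left' (by linarith [Real.pi_pos] : -(2 * Real.pi) ≠ 0)
  have hDint : Integrable fun x => ((D x).toReal : ℂ) :=
    (integrable_toReal_of_lintegral_ne_top hD.aemeasurable hfin).ofReal
  filter_upwards [ae_eq_fourierInv_fourier hDint hfourier_int] with x hx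
  rw [hx, hfourier, inversionIntegral_eq_fourierInv]

lemma integrable_inversionIntegral_sub (μ : Measure ℝ) [IsFiniteMeasure μ] {ψ : ℝ → ℂ}
    (hψ : Integrable ψ) (s : ℝ) : Integrable (fun u => inversionIntegral ψ (s - u)) μ :=
  .of_bound ((continuous_inversionIntegral hψ).comp (continuous_sub_left s)).aestronglyMeasurable
    _ (.of_forall fun u => norm_inversionIntegral_le _ (s - u))

lemma integral_inversionIntegral_sub (μ : Measure ℝ) [IsFiniteMeasure μ] {ψ : ℝ → ℂ}
    (hψ : Integrable ψ) (s : ℝ) :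
    ∫ u, inversionIntegral ψ (s - u) ∂μ = inversionIntegral (fun t => charFun μ t * ψ t) s := by
  have hint : Integrable (Function.uncurry fun u t : ℝ =>
      Complex.exp (-(t * ((s - u : ℝ) : ℂ) * Complex.I)) * ψ t) (μ.prod volume) := by
    have hexp : Continuous fun q : ℝ × ℝ =>
        Complex.exp (-(q.2 * ((s - q.1 : ℝ) : ℂ) * Complex.I)) := by fun_prop
    refine (Integrable.mul_prod (integrable_const (1 : ℝ)) hψ.norm).mono'
      (hexp.aestronglyMeasurable.mul hψ.1.comp_snd) (.of_forall fun q => ?_)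
    rw [Function.uncurry, norm_mul, norm_exp_neg_mul_I]
  simp only [inversionIntegral]
  rw [integral_const_mul, integral_integral_swap hint]
  congr 1
  refine integral_congr_ae (.of_forall fun t => ?_)
  simp only
  rw [integral_mul_const, charFun_apply_real, ← mul_assoc, ← integral_const_mul]
  congr 1
  refine integral_congr_ae (.of_forall fun u => ?_)
  simp only [← Complex.exp_add]
  congr 1
  push_cast
  ring

lemma lintegral_comp_sub_eq_inversionIntegral {μ : Measure ℝ} [IsFiniteMeasure μ]
    (hμ : μ ≪ volume) {D : ℝ → ℝ≥0∞} (hD : Measurable D) (hfin : ∫⁻ x, D x ≠ ∞)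
    (hint : Integrable (charFun (volume.withDensity D))) (s : ℝ) :
    ∫⁻ u, D (s - u) ∂μ ≠ ∞ ∧ ((∫⁻ u, D (s - u) ∂μ).toReal : ℂ) =
      inversionIntegral (fun t => charFun μ t * charFun (volume.withDensity D) t) s := by
  have hreflect : Tendsto (fun u : ℝ => s - u) (ae μ) (ae volume) :=
    ((Measure.measurePreserving_sub_left volume s).quasiMeasurePreserving.mono_left hμ).tendsto_ae
  have hDs : Measurable fun u => D (s - u) := by fun_prop
  have hlt : ∀ᵐ u ∂μ, D (s - u) < ∞ := hreflect.eventually (ae_lt_top hD hfin)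
  have hinv : (fun u => inversionIntegral (charFun (volume.withDensity D)) (s - u)) =ᵐ[μ]
      fun u => ((D (s - u)).toReal : ℂ) :=
    (hreflect.eventually (toReal_ae_eq_inversionIntegral hD hfin hint)).mono fun _ => Eq.symm
  have hDs_int : Integrable (fun u => (D (s - u)).toReal) μ := by
    simpa using ((integrable_inversionIntegral_sub μ hint s).congr hinv).re
  refine ⟨(integrable_toReal_iff hDs.aemeasurable (hlt.mono fun _ => LT.lt.ne)).1 hDs_int, ?_⟩
  rw [← integral_toReal hDs.aemeasurable hlt, ← integral_complex_ofReal,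
    ← integral_congr_ae hinv, integral_inversionIntegral_sub μ hint]

lemma lconvolution_eq_inversionIntegral {h D : ℝ → ℝ≥0∞} (hh : Measurable h) (hD : Measurable D)
    (hfinh : ∫⁻ x, h x ≠ ∞) (hfin : ∫⁻ x, D x ≠ ∞)
    (hint : Integrable (charFun (volume.withDensity D))) (s : ℝ) :
    lconvolution h D volume s ≠ ∞ ∧
    ((lconvolution h D volume s).toReal : ℂ) = inversionIntegral
      (fun t => charFun (volume.withDensity h) t * charFun (volume.withDensity D) t) s := by
  have : IsFiniteMeasure (volume.withDensity h) := isFiniteMeasure_withDensity hfinh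
  have hDs : Measurable fun u => D (s - u) := by fun_prop
  have hconv : lconvolution h D volume s = ∫⁻ u, D (s - u) ∂(volume.withDensity h) := by
    rw [lconvolution_def, lintegral_withDensity_eq_lintegral_mul _ hh hDs]
    simp only [Pi.mul_apply, neg_add_eq_sub]
  rw [hconv]
  exact lintegral_comp_sub_eq_inversionIntegral (withDensity_absolutelyContinuous _ _) hD hfin
    hint s

end Fourier

section LevelSets

lemma lintegral_enorm_sq_charFun_withDensity {D : ℝ → ℝ≥0∞} (hD : Measurable D)
    (hfin : ∫⁻ x, D x ≠ ∞) (hfin_sq : ∫⁻ x, D x ^ 2 ≠ ∞) :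
    ∫⁻ t, ‖charFun (volume.withDensity D) t‖ₑ ^ 2 =
      ENNReal.ofReal (2 * Real.pi) * ∫⁻ x, D x ^ 2 := by
  have hlt := ae_lt_top hD hfin
  have hsq (g : ℝ → ℂ) : eLpNorm g 2 volume ^ 2 = ∫⁻ x, ‖g x‖ₑ ^ 2 := by
    simpa using eLpNorm_nnreal_pow_eq_lintegral (μ := volume) (f := g) (p := 2) two_ne_zero
  have henorm : ∀ᵐ x, ‖((D x).toReal : ℂ)‖ₑ ^ 2 = D x ^ 2 := by
    filter_upwards [hlt] with x hx
    rw [← ofReal_norm, Complex.norm_real, Real.norm_of_nonneg ENNReal.toReal_nonneg,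
      ENNReal.ofReal_toReal hx.ne]
  have hint : Integrable fun x => ((D x).toReal : ℂ) :=
    (integrable_toReal_of_lintegral_ne_top hD.aemeasurable hfin).ofReal
  have hmem : MemLp (fun x => ((D x).toReal : ℂ)) 2 := by
    refine ⟨hint.1, ?_⟩
    refine (ENNReal.pow_lt_top_iff.1 ?_).resolve_right two_ne_zero
    rwa [hsq, lintegral_congr_ae henorm, lt_top_iff_ne_top]
  have hplancherel := congrArg (· ^ 2) (eLpNorm_fourier_eq hint hmem)
  simp only [hsq, lintegral_congr_ae henorm, fourier_toReal_eq_charFun_withDensity hD hlt]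
    at hplancherel
  have hscale := lintegral_ofReal_abs_mul_comp_mul_left
    (g := fun t => ‖charFun (volume.withDensity D) t‖ₑ ^ 2) (by fun_prop)
    (neg_ne_zero.2 Real.two_pi_pos.ne')
  rw [← hscale, abs_neg, abs_of_pos Real.two_pi_pos, lintegral_const_mul _ (by fun_prop),
    hplancherel]

lemma lintegral_enorm_sq_charFun_withDensity_le {D : ℝ → ℝ≥0∞} (hD : Measurable D)
    (hfin : ∫⁻ x, D x ≠ ∞) {K : ℝ≥0∞} (hK : K ≠ ∞) (hDK : ∀ x, D x ≤ K) :
    ∫⁻ t, ‖charFun (volume.withDensity D) t‖ₑ ^ 2 ≤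
      ENNReal.ofReal (2 * Real.pi) * (K * ∫⁻ x, D x) := by
  have hsq : ∫⁻ x, D x ^ 2 ≤ K * ∫⁻ x, D x := by
    rw [← lintegral_const_mul _ hD]
    gcongr with x
    rw [sq]
    gcongr
    exact hDK x
  rw [lintegral_enorm_sq_charFun_withDensity hD hfin
    (ne_top_of_le_ne_top (ENNReal.mul_ne_top hK hfin) hsq)]
  gcongr

lemma charFun_add_measure (μ ν : Measure ℝ) [IsFiniteMeasure μ] [IsFiniteMeasure ν] (t : ℝ) :
    charFun (μ + ν) t = charFun μ t + charFun ν t := by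
  simp only [charFun_eq_integral_innerProbChar]
  exact integral_add_measure (BoundedContinuousFunction.integrable _ _)
    (BoundedContinuousFunction.integrable _ _)

lemma volume_lt_norm_charFun_withDensity_add_le {D₁ D₂ : ℝ → ℝ≥0∞} (hD₁ : Measurable D₁)
    (h₁ : ∫⁻ x, D₁ x ≤ 1) {K : ℝ} (hK : ∀ x, D₁ x ≤ ENNReal.ofReal K) {l : ℝ} (hl : 0 < l)
    (h₂ : ∫⁻ x, D₂ x ≤ ENNReal.ofReal (l / 2)) :
    volume {t | l < ‖charFun (volume.withDensity (D₁ + D₂)) t‖} ≤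
      ENNReal.ofReal (8 * Real.pi * K / l ^ 2) := by
  have hfin₁ : ∫⁻ x, D₁ x ≠ ∞ := ne_top_of_le_ne_top ENNReal.one_ne_top h₁
  have : IsFiniteMeasure (volume.withDensity D₁) := isFiniteMeasure_withDensity hfin₁
  have : IsFiniteMeasure (volume.withDensity D₂) :=
    isFiniteMeasure_withDensity (ne_top_of_le_ne_top ENNReal.ofReal_ne_top h₂)
  have hsmall (t : ℝ) : ‖charFun (volume.withDensity D₂) t‖ ≤ l / 2 := by
    refine (norm_charFun_le t).trans ?_
    rw [measureReal_def, withDensity_apply _ MeasurableSet.univ, Measure.restrict_univ]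
    exact ENNReal.toReal_le_of_le_ofReal (by positivity) h₂
  have hsub : {t | l < ‖charFun (volume.withDensity (D₁ + D₂)) t‖} ⊆
      {t | ENNReal.ofReal ((l / 2) ^ 2) ≤ ‖charFun (volume.withDensity D₁) t‖ₑ ^ 2} := by
    intro t (ht : l < ‖charFun (volume.withDensity (D₁ + D₂)) t‖)
    rw [withDensity_add_left hD₁, charFun_add_measure] at ht
    have hlarge : l / 2 ≤ ‖charFun (volume.withDensity D₁) t‖ := by
      linarith [norm_add_le (charFun (volume.withDensity D₁) t)
        (charFun (volume.withDensity D₂) t), hsmall t]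
    rw [Set.mem_ofPred_eq, ← ofReal_norm, ← ENNReal.ofReal_pow (norm_nonneg _)]
    gcongr
  calc volume {t | l < ‖charFun (volume.withDensity (D₁ + D₂)) t‖}
      ≤ (∫⁻ t, ‖charFun (volume.withDensity D₁) t‖ₑ ^ 2) / ENNReal.ofReal ((l / 2) ^ 2) :=
        (measure_mono hsub).trans (meas_ge_le_lintegral_div (by fun_prop)
          (ENNReal.ofReal_pos.2 (by positivity)).ne' ENNReal.ofReal_ne_top)
    _ ≤ ENNReal.ofReal (2 * Real.pi) * (ENNReal.ofReal K * 1) / ENNReal.ofReal ((l / 2) ^ 2) := by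
        gcongr
        exact (lintegral_enorm_sq_charFun_withDensity_le hD₁ hfin₁ ENNReal.ofReal_ne_top
          hK).trans (by gcongr)
    _ = ENNReal.ofReal (8 * Real.pi * K / l ^ 2) := by
        rw [mul_one, ← ENNReal.ofReal_mul Real.two_pi_pos.le,
          ← ENNReal.ofReal_div_of_pos (by positivity)]
        congr 1
        field_simp
        ring

lemma lintegral_norm_pow_le_of_volume_lt_norm_le {φ : ℝ → ℂ} (hφ : Measurable φ)
    (hφ1 : ∀ t, ‖φ t‖ ≤ 1) {a C : ℝ} (hC : 0 ≤ C) {N : ℕ} [NeZero N] (hN : a + 1 ≤ N)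
    (h : ∀ l : ℝ, 0 < l → l ≤ 1 → volume {t | l < ‖φ t‖} ≤ ENNReal.ofReal (C * l ^ (-a))) :
    ∫⁻ t, ENNReal.ofReal (‖φ t‖ ^ N) ≤ ENNReal.ofReal (N * C) := by
  have hN0 : (0 : ℝ) < N := by exact_mod_cast NeZero.pos N
  have hcake := lintegral_rpow_eq_lintegral_meas_lt_mul volume (f := fun t => ‖φ t‖)
    (.of_forall fun t => norm_nonneg _) hφ.norm.aemeasurable hN0
  simp only [Real.rpow_natCast] at hcake
  rw [hcake, ENNReal.ofReal_mul hN0.le]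
  gcongr
  have hlevel : ∀ l ∈ Set.Ioi (0 : ℝ),
      volume {t | l < ‖φ t‖} * ENNReal.ofReal (l ^ ((N : ℝ) - 1)) ≤
        (Set.Ioc (0 : ℝ) 1).indicator (fun _ => ENNReal.ofReal C) l := by
    intro l (hl0 : 0 < l)
    by_cases hl1 : l ≤ 1
    · rw [Set.indicator_of_mem (show l ∈ Set.Ioc (0 : ℝ) 1 from ⟨hl0, hl1⟩)]
      calc _ ≤ ENNReal.ofReal (C * l ^ (-a)) * ENNReal.ofReal (l ^ ((N : ℝ) - 1)) := by
            gcongr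
            exact h l hl0 hl1
        _ = ENNReal.ofReal (C * l ^ ((N : ℝ) - 1 - a)) := by
            rw [← ENNReal.ofReal_mul (by positivity), mul_assoc, ← Real.rpow_add hl0]
            congr 3
            ring
        _ ≤ ENNReal.ofReal C := by
            refine ENNReal.ofReal_le_ofReal (mul_le_of_le_one_right hC ?_)
            exact Real.rpow_le_one hl0.le hl1 (by linarith)
    · have hempty : {t | l < ‖φ t‖} = ∅ :=
        Set.eq_empty_of_forall_notMem fun t ht => hl1 ((le_of_lt ht).trans (hφ1 t))
      simp [hempty]
  calc _ ≤ ∫⁻ l, (Set.Ioc (0 : ℝ) 1).indicator (fun _ => ENNReal.ofReal C) l :=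
        (setLIntegral_mono' measurableSet_Ioi hlevel).trans (setLIntegral_le_lintegral _ _)
    _ = ENNReal.ofReal C := by simp [lintegral_indicator measurableSet_Ioc]

end LevelSets

section Truncation

variable {E : Type*} [NormedAddCommGroup E] {f : E → ℝ}

/-- The velocities kept by the truncation of `f` at level `T`: those where `f` is at most `T` and
whose length is neither large nor small. On this set the energy has a bounded density. -/
def truncationSet (f : E → ℝ) (T : ℝ) : Set E :=
  {v | f v ≤ T ∧ ‖v‖ ≤ T ∧ (T ^ 2)⁻¹ ≤ ‖v‖}

lemma ofReal_indicator_compl_truncationSet_le {p T : ℝ} (hp : 1 ≤ p) (hT : 0 < T) (v : E) :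
    ENNReal.ofReal ((truncationSet f T)ᶜ.indicator f v) ≤
      ENNReal.ofReal (T ^ (1 - p)) * ENNReal.ofReal (f v ^ p) +
        ENNReal.ofReal ((T ^ 2)⁻¹) * ENNReal.ofReal (‖v‖ ^ 2 * f v) +
        (Metric.ball (0 : E) (T ^ 2)⁻¹).indicator (fun _ => ENNReal.ofReal T) v := by
  by_cases hv : v ∈ truncationSet f T
  · simp [hv]
  rw [Set.indicator_of_mem (show v ∈ (truncationSet f T)ᶜ from hv)]
  rcases lt_or_ge T (f v) with hlarge | hbounded
  · refine le_trans ?_ (le_self_add.trans le_self_add)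
    have hfv : 0 < f v := hT.trans hlarge
    rw [← ENNReal.ofReal_mul (by positivity)]
    gcongr
    calc f v = f v ^ (1 - p) * f v ^ p := by
          rw [← Real.rpow_add hfv, sub_add_cancel, Real.rpow_one]
      _ ≤ T ^ (1 - p) * f v ^ p := by
          gcongr 1
          exact Real.rpow_le_rpow_of_nonpos hT hlarge.le (by linarith)
  rcases lt_or_ge T ‖v‖ with hfar | hnear
  · refine le_trans ?_ (le_add_self.trans le_self_add)
    rw [ENNReal.ofReal_mul (by positivity), ← mul_assoc, ← ENNReal.ofReal_mul (by positivity)]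
    refine le_mul_of_one_le_left' (ENNReal.one_le_ofReal.2 ?_)
    rw [inv_mul_eq_div, one_le_div (by positivity)]
    gcongr
  · have hsmall : ‖v‖ < (T ^ 2)⁻¹ := by
      by_contra! hge
      exact hv ⟨hbounded, hnear, hge⟩
    rw [Set.indicator_of_mem (mem_ball_zero_iff.2 hsmall)]
    exact (ENNReal.ofReal_le_ofReal hbounded).trans le_add_self

variable [MeasurableSpace E] [BorelSpace E]

lemma measurableSet_truncationSet (hf : Measurable f) (T : ℝ) :
    MeasurableSet (truncationSet f T) :=
  (measurableSet_le hf measurable_const).inter ((measurableSet_le measurable_norm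
    measurable_const).inter (measurableSet_le measurable_const measurable_norm))

variable [InnerProductSpace ℝ E] [FiniteDimensional ℝ E]

lemma energyDensity_eq_add_indicator (hf : Measurable f) {s : Set E} (hs : MeasurableSet s) :
    energyDensity f = energyDensity (s.indicator f) + energyDensity (sᶜ.indicator f) := by
  funext u
  rw [Pi.add_apply]
  rcases le_or_gt u 0 with hu | hu
  · simp [energyDensity, radialDensity_of_nonpos _ hu]
  simp only [energyDensity, radialDensity_of_pos _ hu]
  have hmeas : Measurable fun ω : Metric.sphere (0 : E) 1 =>
      ENNReal.ofReal (s.indicator f (√u • (ω : E))) :=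
    (hf.indicator hs).ennreal_ofReal.comp (by fun_prop)
  rw [← mul_add, ← lintegral_add_left hmeas]
  congr 1
  refine lintegral_congr fun ω => ?_
  by_cases h : √u • (ω : E) ∈ s <;> simp [h]

lemma rpow_half_sub_one_le {u T : ℝ} (hu : 0 < u) (hT : 0 < T) (hle : √u ≤ T)
    (hge : (T ^ 2)⁻¹ ≤ √u) (n : ℕ) : u ^ ((n : ℝ) / 2 - 1) ≤ T ^ (n + 4) := by
  have hinv : u⁻¹ ≤ T ^ 4 := by
    calc u⁻¹ = (√u)⁻¹ ^ 2 := by rw [inv_pow, Real.sq_sqrt hu.le]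
      _ ≤ (T ^ 2) ^ 2 := by
        gcongr
        exact inv_le_of_inv_le₀ (by positivity) hge
      _ = T ^ 4 := by ring
  calc u ^ ((n : ℝ) / 2 - 1) = √u ^ n * u⁻¹ := by
        rw [Real.rpow_sub_one hu.ne', Real.sqrt_eq_rpow, ← Real.rpow_mul_natCast hu.le,
          div_eq_mul_inv]
        congr 2
        ring
    _ ≤ T ^ n * T ^ 4 := by gcongr
    _ = T ^ (n + 4) := (pow_add T n 4).symm

lemma energyDensity_indicator_truncationSet_le {T : ℝ} (hT : 0 < T) (u : ℝ) :
    energyDensity ((truncationSet f T).indicator f) u ≤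
      ENNReal.ofReal (T ^ (Module.finrank ℝ E + 5) *
        (volume : Measure E).toSphere.real Set.univ) := by
  rcases le_or_gt u 0 with hu | hu
  · simp [energyDensity, radialDensity_of_nonpos _ hu]
  have hnorm (ω : Metric.sphere (0 : E) 1) : ‖√u • (ω : E)‖ = √u := by
    rw [norm_smul, norm_eq_of_mem_sphere, mul_one, Real.norm_of_nonneg (Real.sqrt_nonneg _)]
  rw [energyDensity, radialDensity_of_pos _ hu]
  by_cases hmem : √u ≤ T ∧ (T ^ 2)⁻¹ ≤ √u
  · have hsphere : ∫⁻ ω : Metric.sphere (0 : E) 1,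
        ENNReal.ofReal ((truncationSet f T).indicator f (√u • (ω : E)))
          ∂(volume : Measure E).toSphere ≤
        ENNReal.ofReal (T * (volume : Measure E).toSphere.real Set.univ) := by
      rw [ENNReal.ofReal_mul hT.le, ofReal_measureReal, ← lintegral_const]
      refine lintegral_mono fun ω => ENNReal.ofReal_le_ofReal ?_
      exact Set.indicator_apply_le' (fun h => h.1) (fun _ => hT.le)
    refine (mul_le_mul_right hsphere _).trans ?_
    rw [← ENNReal.ofReal_mul (by positivity), ← mul_assoc]
    gcongr
    calc u ^ ((Module.finrank ℝ E : ℝ) / 2 - 1) / 2 * T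
        ≤ u ^ ((Module.finrank ℝ E : ℝ) / 2 - 1) * T := by
          gcongr
          exact half_le_self (by positivity)
      _ ≤ T ^ (Module.finrank ℝ E + 4) * T := by
          gcongr
          exact rpow_half_sub_one_le hu hT hmem.1 hmem.2 _
  · have hvanish (ω : Metric.sphere (0 : E) 1) :
        (truncationSet f T).indicator f (√u • (ω : E)) = 0 :=
      Set.indicator_of_notMem (fun h => hmem (by simpa only [hnorm] using h.2)) _
    simp [hvanish]

lemma ofReal_mul_volume_ball_inv_sq_le [Nontrivial E] {T : ℝ} (hT : 1 ≤ T) :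
    ENNReal.ofReal T * volume (Metric.ball (0 : E) (T ^ 2)⁻¹) ≤
      ENNReal.ofReal T⁻¹ * volume (Metric.ball (0 : E) 1) := by
  have hT0 : 0 < T := by linarith
  rw [Measure.addHaar_ball_of_pos _ _ (by positivity), ← mul_assoc,
    ← ENNReal.ofReal_mul hT0.le]
  gcongr
  calc T * (T ^ 2)⁻¹ ^ Module.finrank ℝ E ≤ T * (T ^ 2)⁻¹ := by
        gcongr
        exact pow_le_of_le_one (by positivity) (inv_le_one_of_one_le₀ (one_le_pow₀ hT))
          Module.finrank_pos.ne'
    _ = T⁻¹ := by field_simp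

lemma lintegral_indicator_compl_truncationSet_le [Nontrivial E] (hf : Measurable f) {p T : ℝ}
    (hp : 1 ≤ p) (hT : 1 ≤ T) :
    ∫⁻ v, ENNReal.ofReal ((truncationSet f T)ᶜ.indicator f v) ≤
      ENNReal.ofReal (T ^ (-min 1 (p - 1))) * ((∫⁻ v, ENNReal.ofReal (f v ^ p)) +
        (∫⁻ v, ENNReal.ofReal (‖v‖ ^ 2 * f v)) + volume (Metric.ball (0 : E) 1)) := by
  have hT0 : 0 < T := by linarith
  have hexp_p : T ^ (1 - p) ≤ T ^ (-min 1 (p - 1)) :=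
    Real.rpow_le_rpow_of_exponent_le hT (by linarith [min_le_right 1 (p - 1)])
  have hexp_one : T⁻¹ ≤ T ^ (-min 1 (p - 1)) := by
    rw [← Real.rpow_neg_one]
    exact Real.rpow_le_rpow_of_exponent_le hT (by linarith [min_le_left 1 (p - 1)])
  have hexp_two : (T ^ 2)⁻¹ ≤ T ^ (-min 1 (p - 1)) :=
    (inv_anti₀ hT0 (le_self_pow₀ hT two_ne_zero)).trans hexp_one
  calc _ ≤ ∫⁻ v, (ENNReal.ofReal (T ^ (1 - p)) * ENNReal.ofReal (f v ^ p) +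
        ENNReal.ofReal ((T ^ 2)⁻¹) * ENNReal.ofReal (‖v‖ ^ 2 * f v) +
        (Metric.ball (0 : E) (T ^ 2)⁻¹).indicator (fun _ => ENNReal.ofReal T) v) :=
        lintegral_mono (ofReal_indicator_compl_truncationSet_le hp hT0)
    _ = ENNReal.ofReal (T ^ (1 - p)) * (∫⁻ v, ENNReal.ofReal (f v ^ p)) +
        ENNReal.ofReal ((T ^ 2)⁻¹) * (∫⁻ v, ENNReal.ofReal (‖v‖ ^ 2 * f v)) +
        ENNReal.ofReal T * volume (Metric.ball (0 : E) (T ^ 2)⁻¹) := by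
      rw [lintegral_add_left (by fun_prop), lintegral_add_left (by fun_prop),
        lintegral_const_mul _ (by fun_prop), lintegral_const_mul _ (by fun_prop),
        lintegral_indicator Metric.isOpen_ball.measurableSet, setLIntegral_const]
    _ ≤ _ := by
      rw [mul_add, mul_add]
      exact add_le_add (by gcongr)
        ((ofReal_mul_volume_ball_inv_sq_le hT).trans (by gcongr))

lemma volume_lt_norm_charFun_energyDensity_le [Nontrivial E] (hf : Measurable f)
    (hf1 : ∫⁻ v, ENNReal.ofReal (f v) = 1) {l T : ℝ} (hT : 0 < T) (hl : 0 < l)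
    (htail : ∫⁻ v, ENNReal.ofReal ((truncationSet f T)ᶜ.indicator f v) ≤ ENNReal.ofReal (l / 2)) :
    volume {t | l < ‖charFun (volume.withDensity (energyDensity f)) t‖} ≤
      ENNReal.ofReal (8 * Real.pi * (T ^ (Module.finrank ℝ E + 5) *
        (volume : Measure E).toSphere.real Set.univ) / l ^ 2) := by
  have hs := measurableSet_truncationSet hf T
  rw [energyDensity_eq_add_indicator hf hs]
  refine volume_lt_norm_charFun_withDensity_add_le (measurable_energyDensity (hf.indicator hs)) ?_
    (energyDensity_indicator_truncationSet_le hT) hl ?_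
  · rw [lintegral_energyDensity (hf.indicator hs), ← hf1]
    refine lintegral_mono fun v => ?_
    by_cases hv : v ∈ truncationSet f T <;> simp [hv]
  · rwa [lintegral_energyDensity (hf.indicator hs.compl)]

variable (E) in
/-- A constant bounding the measure of the level sets of the characteristic function of `‖v‖²`,
uniformly over the densities on `E` with `∫ f ^ p ≤ Λ` and mean energy at most `ℰ`. It comes from
truncating at the level `T = (2c / l) ^ (1 / min 1 (p - 1))` with `c = 1 + Λ + ℰ + |B(0, 1)|`. -/
noncomputable def levelSetConst (p : ℝ) (Λ ℰ : ℝ≥0) : ℝ :=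
  8 * Real.pi * (volume : Measure E).toSphere.real Set.univ *
    (2 * (1 + Λ + ℰ + volume.real (Metric.ball (0 : E) 1))) ^
      (((Module.finrank ℝ E + 5 : ℕ) : ℝ) / min 1 (p - 1))

lemma volume_lt_norm_charFun_energyDensity_le_levelSetConst [Nontrivial E] (hf : Measurable f)
    (hf1 : ∫⁻ v, ENNReal.ofReal (f v) = 1) {p : ℝ} (hp : 1 < p) {Λ ℰ : ℝ≥0}
    (hΛ : ∫⁻ v, ENNReal.ofReal (f v ^ p) ≤ Λ)
    (hℰ : ∫⁻ v, ENNReal.ofReal (‖v‖ ^ 2 * f v) ≤ ℰ) {l : ℝ} (hl : 0 < l) (hl1 : l ≤ 1) :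
    volume {t | l < ‖charFun (volume.withDensity (energyDensity f)) t‖} ≤
      ENNReal.ofReal (levelSetConst E p Λ ℰ *
        l ^ (-(((Module.finrank ℝ E + 5 : ℕ) : ℝ) / min 1 (p - 1) + 2))) := by
  have hη : 0 < min 1 (p - 1) := lt_min one_pos (by linarith)
  rw [levelSetConst]
  set η := min 1 (p - 1)
  set c : ℝ := 1 + Λ + ℰ + volume.real (Metric.ball (0 : E) 1) with hc_def
  have hc : 1 ≤ c := by
    have : 0 ≤ (Λ : ℝ) + ℰ + volume.real (Metric.ball (0 : E) 1) := by positivity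
    linarith
  have hquot : 1 ≤ 2 * c / l := by
    rw [one_le_div hl]
    linarith
  have hT : 1 ≤ (2 * c / l) ^ (1 / η) := Real.one_le_rpow hquot (by positivity)
  refine (volume_lt_norm_charFun_energyDensity_le hf hf1 (one_pos.trans_le hT) hl ?_).trans_eq ?_
  · calc _ ≤ ENNReal.ofReal (((2 * c / l) ^ (1 / η)) ^ (-η)) *
          (Λ + ℰ + volume (Metric.ball (0 : E) 1)) :=
        (lintegral_indicator_compl_truncationSet_le hf hp.le hT).trans (by gcongr)
      _ ≤ ENNReal.ofReal (l / (2 * c)) * ENNReal.ofReal c := by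
        rw [← Real.rpow_mul (by positivity), show 1 / η * -η = -1 by field_simp,
          Real.rpow_neg_one, inv_div, hc_def, ENNReal.ofReal_add (by positivity) (by positivity),
          ofReal_measureReal measure_ball_lt_top.ne, ENNReal.ofReal_add (by positivity) (by simp),
          ENNReal.ofReal_add zero_le_one (by simp), ENNReal.ofReal_coe_nnreal,
          ENNReal.ofReal_coe_nnreal]
        gcongr
        exact le_add_self
      _ = ENNReal.ofReal (l / 2) := by
        rw [← ENNReal.ofReal_mul (by positivity)]
        congr 1
        field_simp
  · congr 1
    rw [← Real.rpow_mul_natCast (by positivity), Real.div_rpow (by positivity) hl.le, neg_add,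
      Real.rpow_add hl, Real.rpow_neg hl.le (_ / η), one_div_mul_eq_div, Real.rpow_neg hl.le,
      Real.rpow_two]
    field_simp

variable (E) in
lemma exists_lintegral_norm_charFun_energyDensity_pow_le [Nontrivial E] {p : ℝ} (hp : 1 < p)
    (Λ ℰ : ℝ≥0) :
    ∃ N : ℕ, ∃ C : ℝ, ∀ f : E → ℝ, Measurable f → ∫⁻ v, ENNReal.ofReal (f v) = 1 →
      ∫⁻ v, ENNReal.ofReal (f v ^ p) ≤ Λ → ∫⁻ v, ENNReal.ofReal (‖v‖ ^ 2 * f v) ≤ ℰ →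
      ∫⁻ t, ENNReal.ofReal (‖charFun (volume.withDensity (energyDensity f)) t‖ ^ N) ≤
        ENNReal.ofReal C := by
  have ha : 0 ≤ ((Module.finrank ℝ E + 5 : ℕ) : ℝ) / min 1 (p - 1) :=
    div_nonneg (Nat.cast_nonneg _) (le_min zero_le_one (by linarith))
  have hconst : 0 ≤ levelSetConst E p Λ ℰ := by
    unfold levelSetConst
    positivity
  obtain ⟨N, hN⟩ := exists_nat_ge (((Module.finrank ℝ E + 5 : ℕ) : ℝ) / min 1 (p - 1) + 2 + 1)
  have : NeZero N := ⟨by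
    rintro rfl
    rw [Nat.cast_zero] at hN
    linarith⟩
  refine ⟨N, N * levelSetConst E p Λ ℰ, fun f hf hf1 hΛ hℰ => ?_⟩
  have : IsProbabilityMeasure (volume.withDensity (energyDensity f)) :=
    ⟨by simp [lintegral_energyDensity hf, hf1]⟩
  exact lintegral_norm_pow_le_of_volume_lt_norm_le measurable_charFun norm_charFun_le_one hconst hN
    fun l => volume_lt_norm_charFun_energyDensity_le_levelSetConst hf hf1 hp hΛ hℰ

end Truncation

section SpectralGap

lemma abs_sin_nat_mul_le (n : ℕ) (x : ℝ) : |Real.sin (n * x)| ≤ n * |Real.sin x| := by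
  induction n with
  | zero => simp
  | succ n ih =>
    push_cast
    rw [add_mul, one_mul, Real.sin_add]
    calc |Real.sin (n * x) * Real.cos x + Real.cos (n * x) * Real.sin x|
        ≤ |Real.sin (n * x)| * |Real.cos x| + |Real.cos (n * x)| * |Real.sin x| := by
          rw [← abs_mul, ← abs_mul]
          exact abs_add_le _ _
      _ ≤ |Real.sin (n * x)| * 1 + 1 * |Real.sin x| := by
          gcongr <;> exact Real.abs_cos_le_one _
      _ ≤ (n + 1) * |Real.sin x| := by linarith

lemma one_sub_cos_nat_mul_le (n : ℕ) (x : ℝ) :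
    1 - Real.cos (n * x) ≤ (n : ℝ) ^ 2 * (1 - Real.cos x) := by
  have half_angle (y : ℝ) : 1 - Real.cos y = 2 * |Real.sin (y / 2)| ^ 2 := by
    rw [sq_abs, Real.sin_sq_eq_half_sub, mul_div_cancel₀ y two_ne_zero]
    ring
  calc 1 - Real.cos (n * x) = 2 * |Real.sin (n * (x / 2))| ^ 2 := by
        rw [half_angle, mul_div_assoc]
    _ ≤ 2 * (n * |Real.sin (x / 2)|) ^ 2 := by
        gcongr
        exact abs_sin_nat_mul_le n _
    _ = (n : ℝ) ^ 2 * (1 - Real.cos x) := by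
        rw [half_angle x]
        ring

variable {μ : Measure ℝ}

lemma integrable_exp_ofReal_mul_I [IsFiniteMeasure μ] {g : ℝ → ℝ} (hg : Measurable g) :
    Integrable (fun x => Complex.exp (g x * Complex.I)) μ :=
  .of_bound (by fun_prop) 1 (.of_forall fun x => (Complex.norm_exp_ofReal_mul_I _).le)

lemma re_exp_mul_charFun [IsFiniteMeasure μ] (t c : ℝ) :
    (Complex.exp (-(c * Complex.I)) * charFun μ t).re = ∫ x, Real.cos (t * x - c) ∂μ := by
  have hexp (x : ℝ) : Complex.exp (-(c * Complex.I)) * Complex.exp (t * x * Complex.I) =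
      Complex.exp ((t * x - c : ℝ) * Complex.I) := by
    rw [← Complex.exp_add]
    congr 1
    push_cast
    ring
  simp_rw [charFun_apply_real, ← integral_const_mul, hexp]
  rw [← RCLike.re_eq_complex_re, ← integral_re (integrable_exp_ofReal_mul_I (by fun_prop))]
  simp only [RCLike.re_eq_complex_re, Complex.exp_ofReal_mul_I_re]

lemma norm_charFun_eq_integral_cos [IsFiniteMeasure μ] (t : ℝ) :
    ‖charFun μ t‖ = ∫ x, Real.cos (t * x - (charFun μ t).arg) ∂μ := by
  rw [← re_exp_mul_charFun]
  conv_rhs => rw [← Complex.norm_mul_exp_arg_mul_I (charFun μ t)]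
  rw [mul_left_comm, ← Complex.exp_add]
  simp

lemma integral_cos_le_norm_charFun [IsFiniteMeasure μ] (t c : ℝ) :
    ∫ x, Real.cos (t * x - c) ∂μ ≤ ‖charFun μ t‖ := by
  rw [← re_exp_mul_charFun]
  refine (Complex.re_le_norm _).trans_eq ?_
  rw [norm_mul, Complex.norm_exp]
  simp

lemma one_sub_norm_charFun_nat_mul_le [IsProbabilityMeasure μ] (n : ℕ) (t : ℝ) :
    1 - ‖charFun μ (n * t)‖ ≤ (n : ℝ) ^ 2 * (1 - ‖charFun μ t‖) := by
  set θ := (charFun μ t).arg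
  have hint (r c : ℝ) : Integrable (fun x => Real.cos (r * x - c)) μ :=
    .of_bound (by fun_prop) 1 (.of_forall fun x => by simpa using Real.abs_cos_le_one _)
  have one_sub_integral (r c : ℝ) :
      1 - ∫ x, Real.cos (r * x - c) ∂μ = ∫ x, (1 - Real.cos (r * x - c)) ∂μ := by
    rw [integral_sub (integrable_const _) (hint r c)]
    simp
  calc 1 - ‖charFun μ (n * t)‖ ≤ 1 - ∫ x, Real.cos (n * t * x - n * θ) ∂μ :=
        sub_le_sub_left (integral_cos_le_norm_charFun _ _) _
    _ ≤ (n : ℝ) ^ 2 * (1 - ∫ x, Real.cos (t * x - θ) ∂μ) := by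
        rw [one_sub_integral, one_sub_integral, ← integral_const_mul]
        refine integral_mono ((integrable_const _).sub (hint _ _))
          (((integrable_const _).sub (hint _ _)).const_mul _) fun x => ?_
        simpa only [mul_sub, mul_assoc] using one_sub_cos_nat_mul_le n (t * x - θ)
    _ = (n : ℝ) ^ 2 * (1 - ‖charFun μ t‖) := by rw [norm_charFun_eq_integral_cos t]

lemma norm_charFun_sub_charFun_le [IsFiniteMeasure μ] (hμ : Integrable (fun x => |x|) μ)
    (s t : ℝ) : ‖charFun μ s - charFun μ t‖ ≤ |s - t| * ∫ x, |x| ∂μ := by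
  have hint (r : ℝ) : Integrable (fun x : ℝ => Complex.exp (r * x * Complex.I)) μ :=
    mod_cast integrable_exp_ofReal_mul_I (g := fun x => r * x) (by fun_prop)
  rw [charFun_apply_real, charFun_apply_real, ← integral_sub (hint s) (hint t),
    ← integral_const_mul]
  refine norm_integral_le_of_norm_le (hμ.const_mul _) (.of_forall fun x => ?_)
  have hfactor : Complex.exp (s * x * Complex.I) - Complex.exp (t * x * Complex.I) =
      Complex.exp (t * x * Complex.I) * (Complex.exp (Complex.I * ((s - t) * x : ℝ)) - 1) := by
    rw [mul_sub, ← Complex.exp_add]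
    push_cast
    ring_nf
  rw [hfactor, norm_mul, ← Complex.ofReal_mul, Complex.norm_exp_ofReal_mul_I, one_mul]
  exact Real.norm_exp_I_mul_ofReal_sub_one_le.trans_eq (by rw [Real.norm_eq_abs, abs_mul])

lemma pairwiseDisjoint_ball_nat_mul {t ℓ : ℝ} (hℓt : 2 * ℓ ≤ |t|) (s : Set ℕ) :
    s.PairwiseDisjoint fun j : ℕ => Metric.ball (j * t) ℓ := by
  intro i _ j _ hij
  refine Metric.ball_disjoint_ball ?_
  have hone_le : (1 : ℝ) ≤ |(i : ℝ) - j| := by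
    exact_mod_cast Int.one_le_abs (sub_ne_zero.2 (Nat.cast_injective.ne hij : (i : ℤ) ≠ j))
  rw [Real.dist_eq, ← sub_mul, abs_mul]
  nlinarith [abs_nonneg t]

lemma ofReal_mul_le_lintegral_of_le_on_balls {g : ℝ → ℝ} {t ℓ c : ℝ} (hℓt : 2 * ℓ ≤ |t|)
    (hc : 0 ≤ c) {J : ℕ} (hg : ∀ j < J, ∀ u ∈ Metric.ball (j * t) ℓ, c ≤ g u) :
    ENNReal.ofReal (c * (J * (2 * ℓ))) ≤ ∫⁻ u, ENNReal.ofReal (g u) := by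
  have hmeas : ∀ j ∈ Finset.range J, MeasurableSet (Metric.ball (j * t) ℓ) :=
    fun j _ => Metric.isOpen_ball.measurableSet
  calc ENNReal.ofReal (c * (J * (2 * ℓ)))
      = ENNReal.ofReal c * volume (⋃ j ∈ Finset.range J, Metric.ball (j * t) ℓ) := by
        rw [measure_biUnion_finset (pairwiseDisjoint_ball_nat_mul hℓt _) hmeas]
        simp only [Real.volume_ball, Finset.sum_const, Finset.card_range, nsmul_eq_mul]
        rw [ENNReal.ofReal_mul hc, ENNReal.ofReal_mul J.cast_nonneg, ENNReal.ofReal_natCast]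
    _ = ∫⁻ _ in ⋃ j ∈ Finset.range J, Metric.ball (j * t) ℓ, ENNReal.ofReal c :=
        (setLIntegral_const _ _).symm
    _ ≤ ∫⁻ u in ⋃ j ∈ Finset.range J, Metric.ball (j * t) ℓ, ENNReal.ofReal (g u) := by
        refine setLIntegral_mono' (Finset.measurableSet_biUnion _ hmeas) fun u hu => ?_
        obtain ⟨j, hj, huj⟩ := Set.mem_iUnion₂.1 hu
        exact ENNReal.ofReal_le_ofReal (hg j (Finset.mem_range.1 hj) u huj)
    _ ≤ ∫⁻ u, ENNReal.ofReal (g u) := setLIntegral_le_lintegral _ _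

lemma half_le_norm_charFun_of_mem_ball [IsProbabilityMeasure μ]
    (hμ : Integrable (fun x => |x|) μ) {t u ℓ : ℝ} (hℓ : ℓ * ∫ x, |x| ∂μ ≤ 1 / 4) {j : ℕ}
    (hj : (j : ℝ) ^ 2 * (1 - ‖charFun μ t‖) ≤ 1 / 4) (hu : u ∈ Metric.ball (j * t) ℓ) :
    1 / 2 ≤ ‖charFun μ u‖ := by
  have hlip : ‖charFun μ (j * t) - charFun μ u‖ ≤ 1 / 4 := by
    refine (norm_charFun_sub_charFun_le hμ _ _).trans (le_trans ?_ hℓ)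
    gcongr
    rw [abs_sub_comm, ← Real.dist_eq]
    exact (Metric.mem_ball.1 hu).le
  linarith [one_sub_norm_charFun_nat_mul_le (μ := μ) j t,
    norm_sub_norm_le (charFun μ (j * t)) (charFun μ u)]

/- If `‖charFun μ t‖` were close to `1`, then `‖charFun μ‖` would be at least `1 / 2` near the many
multiples `j t`, too often for its `N`-th power to have integral at most `C`. -/
lemma exists_norm_charFun_le_of_le_abs {δ : ℝ} (hδ : 0 < δ) (N : ℕ) (C M : ℝ) :
    ∃ q : ℝ, 0 ≤ q ∧ q < 1 ∧ ∀ μ : Measure ℝ, IsProbabilityMeasure μ →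
      Integrable (fun x => |x|) μ → ∫ x, |x| ∂μ ≤ M →
      ∫⁻ t, ENNReal.ofReal (‖charFun μ t‖ ^ N) ≤ ENNReal.ofReal C →
      ∀ t, δ ≤ |t| → ‖charFun μ t‖ ≤ q := by
  set ℓ := min (δ / 2) (1 / (4 * (|M| + 1)))
  have : 0 < ℓ := by positivity
  have hℓM : ℓ * M ≤ 1 / 4 := calc
    ℓ * M ≤ ℓ * (|M| + 1) := by
      gcongr
      linarith [le_abs_self M]
    _ ≤ 1 / (4 * (|M| + 1)) * (|M| + 1) := by
      gcongr
      exact min_le_right _ _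
    _ = 1 / 4 := by field_simp
  obtain ⟨J, hJ⟩ := exists_nat_gt (C / ((1 / 2) ^ N * (2 * ℓ)))
  have hJsq : 1 ≤ ((J : ℝ) + 1) ^ 2 := one_le_pow₀ (by simp)
  refine ⟨1 - 1 / (4 * ((J : ℝ) + 1) ^ 2), ?_, sub_lt_self _ (by positivity),
    fun μ _ hμ hM hdecay t ht => ?_⟩
  · rw [sub_nonneg, div_le_one (by positivity)]
    linarith
  by_contra! hclose
  have hlow : ∀ j < J + 1, ∀ u ∈ Metric.ball (j * t) ℓ, (1 / 2) ^ N ≤ ‖charFun μ u‖ ^ N := by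
    intro j hj u hu
    have hℓμ : ℓ * ∫ x, |x| ∂μ ≤ 1 / 4 := le_trans (by gcongr) hℓM
    refine pow_le_pow_left₀ (by norm_num) (half_le_norm_charFun_of_mem_ball hμ hℓμ ?_ hu) N
    have hjJ : (j : ℝ) ≤ J + 1 := by exact_mod_cast hj.le
    calc (j : ℝ) ^ 2 * (1 - ‖charFun μ t‖)
        ≤ ((J : ℝ) + 1) ^ 2 * (1 / (4 * ((J : ℝ) + 1) ^ 2)) := by
          gcongr
          · linarith [norm_charFun_le_one (μ := μ) (t := t)]
          · linarith
      _ = 1 / 4 := by field_simp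
  have hℓt : 2 * ℓ ≤ |t| := by linarith [min_le_left (δ / 2) (1 / (4 * (|M| + 1)))]
  have hle := (ofReal_mul_le_lintegral_of_le_on_balls hℓt (by positivity) hlow).trans hdecay
  rw [div_lt_iff₀ (by positivity)] at hJ
  refine hle.not_gt ((ENNReal.ofReal_lt_ofReal_iff (by positivity)).2 ?_)
  push_cast
  have : 0 < (1 / 2) ^ N * (2 * ℓ) := by positivity
  linarith

end SpectralGap

section Taylor

lemma norm_exp_mul_I_sub_taylor_le (y : ℝ) :
    ‖Complex.exp (y * Complex.I) - (1 + y * Complex.I - y ^ 2 / 2)‖ ≤ 4 * |y| ^ 2 ∧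
    ‖Complex.exp (y * Complex.I) - (1 + y * Complex.I - y ^ 2 / 2)‖ ≤ 4 * |y| ^ 3 := by
  rcases le_or_gt |y| 1 with hy | hy
  · have hcube : ‖Complex.exp (y * Complex.I) - (1 + y * Complex.I - y ^ 2 / 2)‖ ≤ |y| ^ 3 := by
      have hbound := Complex.exp_bound (x := y * Complex.I) (by simpa using hy) three_pos
      have hsum : ∑ m ∈ Finset.range 3, (y * Complex.I) ^ m / (m.factorial : ℂ) =
          1 + y * Complex.I - y ^ 2 / 2 := by
        simp [Finset.sum_range_succ, mul_pow, Nat.factorial]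
        ring
      rw [hsum] at hbound
      refine hbound.trans ?_
      simp only [norm_mul, Complex.norm_real, Real.norm_eq_abs, Complex.norm_I, mul_one]
      exact mul_le_of_le_one_right (by positivity) (by norm_num [Nat.factorial])
    have hpow : |y| ^ 3 ≤ |y| ^ 2 := pow_le_pow_of_le_one (abs_nonneg y) hy (by norm_num)
    have : 0 ≤ |y| ^ 3 := by positivity
    constructor <;> linarith
  · have hterms : ‖Complex.exp (y * Complex.I) - (1 + y * Complex.I - y ^ 2 / 2)‖ ≤
        1 + (1 + |y| + |y| ^ 2 / 2) := by
      refine (norm_sub_le _ _).trans (add_le_add (Complex.norm_exp_ofReal_mul_I y).le ?_)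
      refine (norm_sub_le _ _).trans (add_le_add ((norm_add_le _ _).trans ?_) ?_) <;> simp
    have h1 : |y| ≤ |y| ^ 2 := le_self_pow₀ hy.le two_ne_zero
    have h2 : |y| ^ 2 ≤ |y| ^ 3 := pow_le_pow_right₀ hy.le (by norm_num)
    constructor <;> linarith

variable {μ : Measure ℝ} [IsProbabilityMeasure μ]

lemma charFun_sub_taylor_eq_integral (hint : Integrable (fun x => x) μ)
    (hsq : Integrable (fun x => x ^ 2) μ) (hmean : ∫ x, x ∂μ = 0) (t : ℝ) :
    charFun μ t - (1 - (∫ x, x ^ 2 ∂μ) * t ^ 2 / 2 : ℝ) =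
      ∫ x : ℝ, (Complex.exp ((t * x : ℝ) * Complex.I) -
        (1 + (t * x : ℝ) * Complex.I - ((t * x : ℝ) : ℂ) ^ 2 / 2)) ∂μ := by
  have hlin : Integrable (fun x : ℝ => ((t * x : ℝ) : ℂ) * Complex.I) μ :=
    (hint.const_mul t).ofReal.mul_const _
  have hsq_eq (x : ℝ) : ((t * x : ℝ) : ℂ) ^ 2 / 2 = ((t ^ 2 * x ^ 2 : ℝ) : ℂ) / 2 := by
    push_cast
    ring
  have hquad : Integrable (fun x : ℝ => ((t ^ 2 * x ^ 2 : ℝ) : ℂ) / 2) μ :=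
    ((hsq.const_mul (t ^ 2)).ofReal (𝕜 := ℂ)).div_const 2
  have haff : Integrable (fun x : ℝ => (1 : ℂ) + ((t * x : ℝ) : ℂ) * Complex.I) μ :=
    (integrable_const _).add hlin
  have htaylor : Integrable (fun x : ℝ => (1 : ℂ) + ((t * x : ℝ) : ℂ) * Complex.I -
      ((t ^ 2 * x ^ 2 : ℝ) : ℂ) / 2) μ := haff.sub hquad
  simp_rw [hsq_eq]
  rw [integral_sub (integrable_exp_ofReal_mul_I (by fun_prop)) htaylor,
    integral_sub haff hquad, integral_add (integrable_const _) hlin, integral_mul_const,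
    integral_div, integral_complex_ofReal, integral_complex_ofReal, integral_const_mul,
    integral_const_mul, hmean, charFun_apply_real]
  simp
  ring

lemma norm_charFun_sub_taylor_le (hint : Integrable (fun x => x) μ)
    (hsq : Integrable (fun x => x ^ 2) μ) (hmean : ∫ x, x ∂μ = 0) {R : ℝ} (hR : 0 ≤ R) (t : ℝ) :
    ‖charFun μ t - (1 - (∫ x, x ^ 2 ∂μ) * t ^ 2 / 2 : ℝ)‖ ≤
      4 * |t| ^ 3 * R * (∫ x, x ^ 2 ∂μ) + 4 * t ^ 2 * ∫ x in {x | R < |x|}, x ^ 2 ∂μ := by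
  have hS : MeasurableSet {x : ℝ | R < |x|} := measurableSet_lt (by fun_prop) (by fun_prop)
  rw [charFun_sub_taylor_eq_integral hint hsq hmean]
  have hdom : Integrable (fun x => 4 * |t| ^ 3 * R * x ^ 2 +
      4 * t ^ 2 * {x : ℝ | R < |x|}.indicator (fun x => x ^ 2) x) μ :=
    (hsq.const_mul _).add ((hsq.indicator hS).const_mul _)
  refine (norm_integral_le_of_norm_le hdom (.of_forall fun x => ?_)).trans_eq ?_
  · obtain ⟨hquad, hcube⟩ := norm_exp_mul_I_sub_taylor_le (t * x)
    by_cases hx : x ∈ {x : ℝ | R < |x|}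
    · rw [Set.indicator_of_mem hx]
      refine hquad.trans (le_add_of_nonneg_of_le (by positivity) ?_)
      rw [sq_abs, mul_pow, mul_assoc]
    · rw [Set.indicator_of_notMem hx, mul_zero, add_zero]
      have hxR : |x| ≤ R := not_lt.1 hx
      calc _ ≤ 4 * |t * x| ^ 3 := hcube
        _ = 4 * |t| ^ 3 * |x| * x ^ 2 := by
          rw [abs_mul, ← sq_abs x]
          ring
        _ ≤ 4 * |t| ^ 3 * R * x ^ 2 := by gcongr
  · rw [integral_add (hsq.const_mul _) ((hsq.indicator hS).const_mul _), integral_const_mul,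
      integral_const_mul, integral_indicator hS]

end Taylor

section GaussianIntegral

lemma norm_pow_sub_pow_le_of_norm_le {x y : ℂ} {q : ℝ} (hx : ‖x‖ ≤ q) (hy : ‖y‖ ≤ q) (m : ℕ) :
    ‖x ^ m - y ^ m‖ ≤ m * ‖x - y‖ * q ^ (m - 1) := by
  have hq : 0 ≤ q := (norm_nonneg x).trans hx
  have hsum : ‖∑ i ∈ Finset.range m, x ^ i * y ^ (m - 1 - i)‖ ≤ m * q ^ (m - 1) := by
    refine (norm_sum_le _ _).trans ?_
    refine (Finset.sum_le_sum (g := fun _ => q ^ (m - 1)) fun i hi => ?_).trans_eq (by simp)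
    have hi' : i + (m - 1 - i) = m - 1 := by
      have := Finset.mem_range.1 hi
      omega
    calc ‖x ^ i * y ^ (m - 1 - i)‖ = ‖x‖ ^ i * ‖y‖ ^ (m - 1 - i) := by
          rw [norm_mul, norm_pow, norm_pow]
      _ ≤ q ^ i * q ^ (m - 1 - i) := by gcongr
      _ = q ^ (m - 1) := by rw [← pow_add, hi']
  rw [← (Commute.all x y).geom_sum₂_mul, norm_mul, mul_right_comm]
  gcongr

/- The `m` factors contribute `m ε t² exp (-(m - 1) v t² / 4)`; absorbing `m v t²` into part of the
exponential leaves a Gaussian, of integral `O(1 / √m)`. -/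
lemma norm_pow_sub_gaussian_le_of_small {z : ℂ} {v t ε : ℝ} (hv : 0 < v) {m : ℕ} (hm : 2 ≤ m)
    (hsub : ‖z - (Real.exp (-(v * t ^ 2 / 2)) : ℝ)‖ ≤ ε * t ^ 2)
    (hz : ‖z‖ ≤ Real.exp (-(v * t ^ 2 / 4))) (hε : 0 ≤ ε) :
    ‖z ^ m - (Real.exp (-(m * v * t ^ 2 / 2)) : ℝ)‖ ≤
      16 * ε / v * Real.exp (-(m * v / 16) * t ^ 2) := by
  have hm' : (2 : ℝ) ≤ m := by exact_mod_cast hm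
  have hgauss : ‖((Real.exp (-(v * t ^ 2 / 2)) : ℝ) : ℂ)‖ ≤ Real.exp (-(v * t ^ 2 / 4)) := by
    rw [Complex.norm_real, Real.norm_of_nonneg (Real.exp_pos _).le]
    exact Real.exp_le_exp.2 (by linarith [mul_nonneg hv.le (sq_nonneg t)])
  have hpow : ((Real.exp (-(m * v * t ^ 2 / 2)) : ℝ) : ℂ) =
      ((Real.exp (-(v * t ^ 2 / 2)) : ℝ) : ℂ) ^ m := by
    rw [← Complex.ofReal_pow, ← Real.exp_nat_mul]
    congr 2
    ring
  have hexp_pow :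
      Real.exp (-(v * t ^ 2 / 4)) ^ (m - 1) ≤ Real.exp (-(2 * (m * v / 16 * t ^ 2))) := by
    rw [← Real.exp_nat_mul, Nat.cast_sub (by omega)]
    refine Real.exp_le_exp.2 ?_
    push_cast
    nlinarith [mul_nonneg hv.le (sq_nonneg t)]
  have habsorb : m * v / 16 * t ^ 2 ≤ Real.exp (m * v / 16 * t ^ 2) :=
    (le_add_of_nonneg_right zero_le_one).trans (Real.add_one_le_exp _)
  calc ‖z ^ m - (Real.exp (-(m * v * t ^ 2 / 2)) : ℝ)‖
      ≤ m * ‖z - (Real.exp (-(v * t ^ 2 / 2)) : ℝ)‖ * Real.exp (-(v * t ^ 2 / 4)) ^ (m - 1) :=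
        hpow ▸ norm_pow_sub_pow_le_of_norm_le hz hgauss m
    _ ≤ m * (ε * t ^ 2) * Real.exp (-(2 * (m * v / 16 * t ^ 2))) := by gcongr
    _ = 16 * ε / v * ((m * v / 16 * t ^ 2) * Real.exp (-(2 * (m * v / 16 * t ^ 2)))) := by
        field_simp
    _ ≤ 16 * ε / v * (Real.exp (m * v / 16 * t ^ 2) * Real.exp (-(2 * (m * v / 16 * t ^ 2)))) := by
        gcongr
    _ = 16 * ε / v * Real.exp (-(m * v / 16) * t ^ 2) := by
        rw [← Real.exp_add]
        congr 2
        ring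

lemma sqrt_mul_integral_exp_neg_mul_sq {v : ℝ} (hv : 0 < v) {κ : ℝ} (hκ : 0 < κ) :
    √(v / (2 * Real.pi)) * ∫ t : ℝ, Real.exp (-(v / κ) * t ^ 2) = √(κ / 2) := by
  rw [integral_gaussian, ← Real.sqrt_mul (by positivity)]
  congr 1
  field_simp

section

variable {φ : ℝ → ℂ} {v δ q ε : ℝ} {N m : ℕ}

lemma norm_pow_sub_gaussian_le (hv : 0 < v) (hδ : 0 ≤ δ) (hε : 0 ≤ ε)
    (hnear : ∀ t, |t| ≤ δ → ‖φ t - (Real.exp (-(v * t ^ 2 / 2)) : ℝ)‖ ≤ ε * t ^ 2 ∧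
      ‖φ t‖ ≤ Real.exp (-(v * t ^ 2 / 4)))
    (hfar : ∀ t, δ ≤ |t| → ‖φ t‖ ≤ q) (hm : 2 ≤ m) (hNm : N ≤ m) (t : ℝ) :
    ‖φ t ^ m - (Real.exp (-(m * v * t ^ 2 / 2)) : ℝ)‖ ≤
      16 * ε / v * Real.exp (-(m * v / 16) * t ^ 2) + q ^ (m - N) * ‖φ t‖ ^ N +
        Real.exp (-(m * (v * δ ^ 2 / 4))) * Real.exp (-(m * v / 4) * t ^ 2) := by
  have hq : 0 ≤ q := (norm_nonneg _).trans (hfar δ (le_abs_self δ))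
  have h₁ : 0 ≤ 16 * ε / v * Real.exp (-(m * v / 16) * t ^ 2) := by positivity
  rcases le_or_gt |t| δ with ht | ht
  · have hsmall := norm_pow_sub_gaussian_le_of_small hv hm (hnear t ht).1 (hnear t ht).2 hε
    rw [add_assoc]
    exact hsmall.trans (le_add_of_nonneg_right (by positivity))
  · rw [add_assoc]
    refine (norm_sub_le _ _).trans (le_add_of_nonneg_of_le h₁ (add_le_add ?_ ?_))
    · calc ‖φ t ^ m‖ = ‖φ t‖ ^ (m - N) * ‖φ t‖ ^ N := by
            rw [norm_pow, ← pow_add, Nat.sub_add_cancel hNm]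
        _ ≤ q ^ (m - N) * ‖φ t‖ ^ N := by
            gcongr
            exact hfar t ht.le
    · rw [Complex.norm_real, Real.norm_of_nonneg (Real.exp_pos _).le, ← Real.exp_add,
        Real.exp_le_exp]
      have hδt : m * v / 4 * δ ^ 2 ≤ m * v / 4 * t ^ 2 := by
        rw [← sq_abs t]
        gcongr
      linarith

lemma sqrt_mul_integral_norm_pow_sub_gaussian_le (hv : 0 < v) (hδ : 0 ≤ δ) (hε : 0 ≤ ε)
    (hnear : ∀ t, |t| ≤ δ → ‖φ t - (Real.exp (-(v * t ^ 2 / 2)) : ℝ)‖ ≤ ε * t ^ 2 ∧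
      ‖φ t‖ ≤ Real.exp (-(v * t ^ 2 / 4)))
    (hfar : ∀ t, δ ≤ |t| → ‖φ t‖ ≤ q) (hint : Integrable fun t => ‖φ t‖ ^ N) (hm : 2 ≤ m)
    (hNm : N ≤ m) :
    √(m * v / (2 * Real.pi)) * ∫ t, ‖φ t ^ m - (Real.exp (-(m * v * t ^ 2 / 2)) : ℝ)‖ ≤
      64 * ε / v + √(m * v / (2 * Real.pi)) * (q ^ (m - N) * ∫ t, ‖φ t‖ ^ N) +
        2 * Real.exp (-(m * (v * δ ^ 2 / 4))) := by
  have hm' : (0 : ℝ) < m := by exact_mod_cast (by omega : 0 < m)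
  have hgauss {κ : ℝ} (hκ : 0 < κ) (c : ℝ) :
      Integrable fun t : ℝ => c * Real.exp (-(m * v / κ) * t ^ 2) :=
    (integrable_exp_neg_mul_sq (by positivity)).const_mul c
  have hint₁ := hgauss (κ := 16) (by norm_num) (16 * ε / v)
  have hint₂ : Integrable fun t => q ^ (m - N) * ‖φ t‖ ^ N := hint.const_mul _
  have hint₃ := hgauss (κ := 4) (by norm_num) (Real.exp (-(m * (v * δ ^ 2 / 4))))
  have hint₁₂ : Integrable fun t =>
      16 * ε / v * Real.exp (-(m * v / 16) * t ^ 2) + q ^ (m - N) * ‖φ t‖ ^ N := hint₁.add hint₂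
  set w := √(m * v / (2 * Real.pi))
  have hw₁ : w * ∫ t : ℝ, Real.exp (-(m * v / 16) * t ^ 2) ≤ 4 := by
    rw [sqrt_mul_integral_exp_neg_mul_sq (mul_pos hm' hv) (by norm_num)]
    exact Real.sqrt_le_iff.2 (by norm_num)
  have hw₃ : w * ∫ t : ℝ, Real.exp (-(m * v / 4) * t ^ 2) ≤ 2 := by
    rw [sqrt_mul_integral_exp_neg_mul_sq (mul_pos hm' hv) (by norm_num)]
    exact Real.sqrt_le_iff.2 (by norm_num)
  calc w * ∫ t, ‖φ t ^ m - (Real.exp (-(m * v * t ^ 2 / 2)) : ℝ)‖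
      ≤ w * ∫ t, (16 * ε / v * Real.exp (-(m * v / 16) * t ^ 2) + q ^ (m - N) * ‖φ t‖ ^ N +
          Real.exp (-(m * (v * δ ^ 2 / 4))) * Real.exp (-(m * v / 4) * t ^ 2)) := by
        refine mul_le_mul_of_nonneg_left (integral_mono_of_nonneg (.of_forall fun t =>
          norm_nonneg _) (hint₁₂.add hint₃) (.of_forall fun t => ?_)) (Real.sqrt_nonneg _)
        exact norm_pow_sub_gaussian_le hv hδ hε hnear hfar hm hNm t
    _ = 16 * ε / v * (w * ∫ t : ℝ, Real.exp (-(m * v / 16) * t ^ 2)) +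
          w * (q ^ (m - N) * ∫ t, ‖φ t‖ ^ N) +
          Real.exp (-(m * (v * δ ^ 2 / 4))) *
            (w * ∫ t : ℝ, Real.exp (-(m * v / 4) * t ^ 2)) := by
        rw [integral_add hint₁₂ hint₃, integral_add hint₁ hint₂, integral_const_mul,
          integral_const_mul, integral_const_mul]
        ring
    _ ≤ 16 * ε / v * 4 + w * (q ^ (m - N) * ∫ t, ‖φ t‖ ^ N) +
          Real.exp (-(m * (v * δ ^ 2 / 4))) * 2 := by gcongr
    _ = _ := by ring

end

lemma tendsto_natCast_mul_pow_sub {q : ℝ} (hq0 : 0 ≤ q) (hq1 : q < 1) (N : ℕ) :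
    Tendsto (fun m : ℕ => (m : ℝ) * q ^ (m - N)) atTop (𝓝 0) := by
  rw [← tendsto_add_atTop_iff_nat N]
  have hlin := tendsto_self_mul_const_pow_of_lt_one hq0 hq1
  have hconst := (tendsto_pow_atTop_nhds_zero_of_lt_one hq0 hq1).const_mul (N : ℝ)
  simpa [add_mul] using hlin.add hconst

lemma inversionIntegral_sub {ψ₁ ψ₂ : ℝ → ℂ} (h₁ : Integrable ψ₁) (h₂ : Integrable ψ₂) (s : ℝ) :
    inversionIntegral (fun t => ψ₁ t - ψ₂ t) s =
      inversionIntegral ψ₁ s - inversionIntegral ψ₂ s := by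
  have hint {ψ : ℝ → ℂ} (hψ : Integrable ψ) :
      Integrable fun t : ℝ => Complex.exp (-(t * s * Complex.I)) * ψ t :=
    hψ.bdd_mul (by fun_prop) (.of_forall fun t => (norm_exp_neg_mul_I t s).le)
  simp only [inversionIntegral, mul_sub]
  rw [integral_sub (hint h₁) (hint h₂), mul_sub]

lemma inversionIntegral_exp_mul (ψ : ℝ → ℂ) (c s : ℝ) :
    inversionIntegral (fun t => Complex.exp (t * c * Complex.I) * ψ t) s =
      inversionIntegral ψ (s - c) := by
  simp only [inversionIntegral, ← mul_assoc, ← Complex.exp_add]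
  congr! 5
  push_cast
  ring

lemma integral_exp_neg_mul_gaussian {v : ℝ} (hv : 0 < v) (s : ℝ) :
    ∫ t : ℝ, Complex.exp (-(t * s * Complex.I)) * (Real.exp (-(v * t ^ 2 / 2)) : ℝ) =
      (√(2 * Real.pi / v) : ℝ) * (Real.exp (-s ^ 2 / (2 * v)) : ℝ) := by
  have hre : 0 < ((v / 2 : ℝ) : ℂ).re := by simpa using hv
  have hcpow : ((Real.pi : ℂ) / ((v / 2 : ℝ) : ℂ)) ^ (1 / 2 : ℂ) = (√(2 * Real.pi / v) : ℝ) := by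
    rw [Real.sqrt_eq_rpow, Complex.ofReal_cpow (by positivity)]
    congr 1
    · push_cast
      field_simp
    · push_cast
      rfl
  calc _ = ∫ t : ℝ, Complex.exp (Complex.I * (-s : ℂ) * t) *
        Complex.exp (-((v / 2 : ℝ) : ℂ) * t ^ 2) := by
        congr! 3
        · congr 1
          ring
        · push_cast
          congr 1
          ring
    _ = _ := by
        rw [fourierIntegral_gaussian hre, hcpow]
        congr 1
        push_cast
        congr 1
        field_simp
        ring

lemma inversionIntegral_gaussian {v : ℝ} (hv : 0 < v) (s : ℝ) :
    ((√(2 * Real.pi * v) : ℝ) : ℂ) *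
      inversionIntegral (fun t => (Real.exp (-(v * t ^ 2 / 2)) : ℝ)) s =
      (Real.exp (-s ^ 2 / (2 * v)) : ℝ) := by
  have hsqrt : ((√(2 * Real.pi * v) : ℝ) : ℂ) * ((√(2 * Real.pi / v) : ℝ) : ℂ) = 2 * Real.pi := by
    rw [← Complex.ofReal_mul, ← Real.sqrt_mul (by positivity),
      show 2 * Real.pi * v * (2 * Real.pi / v) = (2 * Real.pi) ^ 2 by field_simp,
      Real.sqrt_sq (by positivity)]
    push_cast
    rfl
  rw [inversionIntegral, integral_exp_neg_mul_gaussian hv, mul_left_comm,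
    ← mul_assoc (√(2 * Real.pi * v) : ℂ), hsqrt, inv_mul_cancel_left₀ (by simp)]

end GaussianIntegral

section CharFunEstimates

variable {μ : Measure ℝ} [IsProbabilityMeasure μ]

lemma integrable_id_of_integrable_sq (hsq : Integrable (fun x => x ^ 2) μ) :
    Integrable (fun x : ℝ => x) μ :=
  ((memLp_two_iff_integrable_sq (by fun_prop)).2 hsq).integrable (by norm_num)

lemma integral_abs_le_integral_sq_add_one (hsq : Integrable (fun x => x ^ 2) μ) :
    ∫ x, |x| ∂μ ≤ (∫ x, x ^ 2 ∂μ) + 1 := by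
  calc ∫ x, |x| ∂μ ≤ ∫ x, (x ^ 2 + 1) ∂μ :=
        integral_mono (integrable_id_of_integrable_sq hsq).abs (hsq.add (integrable_const 1))
          fun x => by nlinarith [sq_abs x, sq_nonneg (|x| - 1)]
    _ = (∫ x, x ^ 2 ∂μ) + 1 := by
        rw [integral_add hsq (integrable_const 1)]
        simp

lemma integral_sq_le_sq_add_setIntegral (hsq : Integrable (fun x => x ^ 2) μ) (R : ℝ) :
    ∫ x, x ^ 2 ∂μ ≤ R ^ 2 + ∫ x in {x | R < |x|}, x ^ 2 ∂μ := by
  have hS : MeasurableSet {x : ℝ | R < |x|} := measurableSet_lt (by fun_prop) (by fun_prop)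
  calc ∫ x, x ^ 2 ∂μ ≤ ∫ x, (R ^ 2 + {x : ℝ | R < |x|}.indicator (fun x => x ^ 2) x) ∂μ := by
        refine integral_mono hsq ((integrable_const _).add (hsq.indicator hS)) fun x => ?_
        by_cases hx : x ∈ {x : ℝ | R < |x|}
        · simpa [Set.indicator_of_mem hx] using sq_nonneg R
        · simpa [Set.indicator_of_notMem hx] using
            sq_le_sq.2 ((not_lt.1 hx).trans (le_abs_self R))
    _ = R ^ 2 + ∫ x in {x | R < |x|}, x ^ 2 ∂μ := by
        rw [integral_add (integrable_const _) (hsq.indicator hS), integral_indicator hS]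
        simp

lemma norm_charFun_sub_gaussian_le (hsq : Integrable (fun x => x ^ 2) μ) (hmean : ∫ x, x ∂μ = 0)
    {R : ℝ} (hR : 0 ≤ R) {t : ℝ} (ht : (∫ x, x ^ 2 ∂μ) * t ^ 2 / 2 ≤ 1) :
    ‖charFun μ t - (Real.exp (-((∫ x, x ^ 2 ∂μ) * t ^ 2 / 2)) : ℝ)‖ ≤
      4 * |t| ^ 3 * R * (∫ x, x ^ 2 ∂μ) + 4 * t ^ 2 * ∫ x in {x | R < |x|}, x ^ 2 ∂μ +
        ((∫ x, x ^ 2 ∂μ) * t ^ 2 / 2) ^ 2 := by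
  set y := (∫ x, x ^ 2 ∂μ) * t ^ 2 / 2
  have hy : |-y| ≤ 1 := by
    have : 0 ≤ ∫ x, x ^ 2 ∂μ := integral_nonneg fun x => sq_nonneg x
    rwa [abs_neg, abs_of_nonneg (by positivity)]
  have hexp : ‖((1 - y : ℝ) : ℂ) - (Real.exp (-y) : ℝ)‖ ≤ y ^ 2 := by
    rw [← Complex.ofReal_sub, Complex.norm_real, Real.norm_eq_abs, abs_sub_comm, ← neg_sq y,
      show Real.exp (-y) - (1 - y) = Real.exp (-y) - 1 - -y by ring]
    exact Real.abs_exp_sub_one_sub_id_le hy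
  exact (norm_sub_le_norm_sub_add_norm_sub _ _ _).trans (add_le_add
    (norm_charFun_sub_taylor_le (integrable_id_of_integrable_sq hsq) hsq hmean hR t) hexp)

lemma norm_charFun_le_gaussian (hsq : Integrable (fun x => x ^ 2) μ) (hmean : ∫ x, x ∂μ = 0)
    {R : ℝ} (hR : 0 ≤ R) {t : ℝ} (ht : (∫ x, x ^ 2 ∂μ) * t ^ 2 / 2 ≤ 1)
    (hsmall : 4 * |t| ^ 3 * R * (∫ x, x ^ 2 ∂μ) + 4 * t ^ 2 * ∫ x in {x | R < |x|}, x ^ 2 ∂μ ≤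
      (∫ x, x ^ 2 ∂μ) * t ^ 2 / 4) :
    ‖charFun μ t‖ ≤ Real.exp (-((∫ x, x ^ 2 ∂μ) * t ^ 2 / 4)) := by
  set v := ∫ x, x ^ 2 ∂μ
  calc ‖charFun μ t‖
      ≤ ‖((1 - v * t ^ 2 / 2 : ℝ) : ℂ)‖ + ‖charFun μ t - (1 - v * t ^ 2 / 2 : ℝ)‖ :=
        norm_le_norm_add_norm_sub' _ _
    _ ≤ (1 - v * t ^ 2 / 2) + v * t ^ 2 / 4 := by
        refine add_le_add ?_ ((norm_charFun_sub_taylor_le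
          (integrable_id_of_integrable_sq hsq) hsq hmean hR t).trans hsmall)
        rw [Complex.norm_real, Real.norm_of_nonneg (by linarith)]
    _ = -(v * t ^ 2 / 4) + 1 := by ring
    _ ≤ Real.exp (-(v * t ^ 2 / 4)) := Real.add_one_le_exp _

end CharFunEstimates

lemma sqrt_mul_div_two_pi_le {v b : ℝ} (hv : 0 ≤ v) (hvb : v ≤ b) (m : ℕ) :
    √(m * v / (2 * Real.pi)) ≤ √b * m := by
  have hm : (m : ℝ) ≤ m ^ 2 := by exact_mod_cast Nat.le_self_pow two_ne_zero m
  refine Real.sqrt_le_iff.2 ⟨by positivity, ?_⟩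
  rw [mul_pow, Real.sq_sqrt (hv.trans hvb)]
  calc m * v / (2 * Real.pi) ≤ m * v :=
        div_le_self (by positivity) (by linarith [Real.pi_gt_three])
    _ ≤ m ^ 2 * b := by gcongr
    _ = b * m ^ 2 := mul_comm _ _

/-- A class of centred probability laws on the line to which the local central limit theorem
applies uniformly: the variances are bounded below by `a`, their tails are uniformly small, and the
`N`-th powers of the characteristic functions are bounded in `L¹` by `C`. -/
structure UniformLocalClass (𝓒 : Set (Measure ℝ)) (a C : ℝ) (N : ℕ) : Prop where
  pos : 0 < a
  prob : ∀ μ ∈ 𝓒, IsProbabilityMeasure μ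
  sq_integrable : ∀ μ ∈ 𝓒, Integrable (fun x => x ^ 2) μ
  integral_eq_zero : ∀ μ ∈ 𝓒, ∫ x, x ∂μ = 0
  le_var : ∀ μ ∈ 𝓒, a ≤ ∫ x, x ^ 2 ∂μ
  tail : ∀ ε > 0, ∃ R : ℝ, 0 ≤ R ∧ ∀ μ ∈ 𝓒, ∫ x in {x | R < |x|}, x ^ 2 ∂μ ≤ ε
  decay : ∀ μ ∈ 𝓒, ∫⁻ t, ENNReal.ofReal (‖charFun μ t‖ ^ N) ≤ ENNReal.ofReal C

namespace UniformLocalClass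

variable {𝓒 : Set (Measure ℝ)} {μ : Measure ℝ} {a C ε : ℝ} {N : ℕ}

lemma exists_var_le (h : UniformLocalClass 𝓒 a C N) :
    ∃ b : ℝ, 0 ≤ b ∧ ∀ μ ∈ 𝓒, ∫ x, x ^ 2 ∂μ ≤ b := by
  obtain ⟨R, -, hR⟩ := h.tail 1 one_pos
  refine ⟨R ^ 2 + 1, by positivity, fun μ hμ => ?_⟩
  have := h.prob μ hμ
  exact (integral_sq_le_sq_add_setIntegral (h.sq_integrable μ hμ) R).trans
    (by linarith [hR μ hμ])

lemma exists_norm_charFun_le (h : UniformLocalClass 𝓒 a C N) {δ : ℝ} (hδ : 0 < δ) :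
    ∃ q : ℝ, 0 ≤ q ∧ q < 1 ∧ ∀ μ ∈ 𝓒, ∀ t, δ ≤ |t| → ‖charFun μ t‖ ≤ q := by
  obtain ⟨b, -, hb⟩ := h.exists_var_le
  obtain ⟨q, hq0, hq1, hq⟩ := exists_norm_charFun_le_of_le_abs hδ N C (b + 1)
  refine ⟨q, hq0, hq1, fun μ hμ => ?_⟩
  have := h.prob μ hμ
  have hsq := h.sq_integrable μ hμ
  exact hq μ this (integrable_id_of_integrable_sq hsq).abs
    ((integral_abs_le_integral_sq_add_one hsq).trans (by linarith [hb μ hμ])) (h.decay μ hμ)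

lemma exists_pos_taylor_error_le (h : UniformLocalClass 𝓒 a C N) (hε : 0 < ε) :
    ∃ δ > 0, ∃ R : ℝ, 0 ≤ R ∧ ∀ μ ∈ 𝓒, ∀ t : ℝ, |t| ≤ δ → (∫ x, x ^ 2 ∂μ) * t ^ 2 / 2 ≤ 1 ∧
      4 * |t| ^ 3 * R * (∫ x, x ^ 2 ∂μ) + 4 * t ^ 2 * ∫ x in {x | R < |x|}, x ^ 2 ∂μ ≤ ε * t ^ 2 ∧
      ((∫ x, x ^ 2 ∂μ) * t ^ 2 / 2) ^ 2 ≤ ε * t ^ 2 := by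
  obtain ⟨b, hb0, hb⟩ := h.exists_var_le
  obtain ⟨R, hR, htail⟩ := h.tail (ε / 8) (by positivity)
  have hδ_small : ∀ᶠ δ in 𝓝 (0 : ℝ), 4 * δ * R * b < ε / 2 ∧ (b * δ / 2) ^ 2 < ε ∧
      b * δ ^ 2 / 2 < 1 := by
    refine .and ?_ (.and ?_ ?_) <;>
    exact (Continuous.tendsto' (by fun_prop) 0 0 (by simp)).eventually_lt_const (by positivity)
  obtain ⟨δ, ⟨hcube, hquart, hsq⟩, hδ : 0 < δ⟩ :=
    ((hδ_small.filter_mono nhdsWithin_le_nhds).and self_mem_nhdsWithin).exists (f := 𝓝[>] 0)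
  refine ⟨δ, hδ, R, hR, fun μ hμ t ht => ?_⟩
  have ht_sq : t ^ 2 ≤ δ ^ 2 := by
    rw [← sq_abs]
    gcongr
  have hvb := hb μ hμ
  have hv0 : 0 < ∫ x, x ^ 2 ∂μ := h.pos.trans_le (h.le_var μ hμ)
  set v := ∫ x, x ^ 2 ∂μ
  refine ⟨le_trans (by gcongr) hsq.le, ?_, ?_⟩
  · calc _ ≤ 4 * |t| ^ 3 * R * v + 4 * t ^ 2 * (ε / 8) := by
          gcongr
          exact htail μ hμ
      _ = (4 * |t| * R * v + ε / 2) * t ^ 2 := by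
          rw [← sq_abs t]
          ring
      _ ≤ (4 * δ * R * b + ε / 2) * t ^ 2 := by gcongr
      _ ≤ ε * t ^ 2 := by
          gcongr
          linarith
  · calc (v * t ^ 2 / 2) ^ 2 = (v / 2) ^ 2 * t ^ 2 * t ^ 2 := by ring
      _ ≤ (b / 2) ^ 2 * δ ^ 2 * t ^ 2 := by gcongr
      _ = (b * δ / 2) ^ 2 * t ^ 2 := by ring
      _ ≤ ε * t ^ 2 := by gcongr

lemma exists_pos_norm_charFun_sub_gaussian_le (h : UniformLocalClass 𝓒 a C N) (hε : 0 < ε) :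
    ∃ δ > 0, ∀ μ ∈ 𝓒, ∀ t : ℝ, |t| ≤ δ →
      ‖charFun μ t - (Real.exp (-((∫ x, x ^ 2 ∂μ) * t ^ 2 / 2)) : ℝ)‖ ≤ ε * t ^ 2 ∧
      ‖charFun μ t‖ ≤ Real.exp (-((∫ x, x ^ 2 ∂μ) * t ^ 2 / 4)) := by
  have ha := h.pos
  obtain ⟨δ, hδ, R, hR, herror⟩ :=
    h.exists_pos_taylor_error_le (ε := min (ε / 2) (a / 4)) (by positivity)
  refine ⟨δ, hδ, fun μ hμ t ht => ?_⟩
  have := h.prob μ hμ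
  have hsq := h.sq_integrable μ hμ
  have hmean := h.integral_eq_zero μ hμ
  obtain ⟨hvt, hthird, hfourth⟩ := herror μ hμ t ht
  constructor
  · calc _ ≤ min (ε / 2) (a / 4) * t ^ 2 + min (ε / 2) (a / 4) * t ^ 2 :=
          (norm_charFun_sub_gaussian_le hsq hmean hR hvt).trans (add_le_add hthird hfourth)
      _ ≤ ε / 2 * t ^ 2 + ε / 2 * t ^ 2 := by
          gcongr <;> exact min_le_left _ _
      _ = ε * t ^ 2 := by ring
  · refine norm_charFun_le_gaussian hsq hmean hR hvt (hthird.trans ?_)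
    calc min (ε / 2) (a / 4) * t ^ 2 ≤ (∫ x, x ^ 2 ∂μ) / 4 * t ^ 2 := by
          gcongr
          exact (min_le_right _ _).trans (by linarith [h.le_var μ hμ])
      _ = (∫ x, x ^ 2 ∂μ) * t ^ 2 / 4 := by ring

lemma integrable_norm_charFun_pow (h : UniformLocalClass 𝓒 a C N) (hμ : μ ∈ 𝓒) :
    Integrable fun t => ‖charFun μ t‖ ^ N := by
  have := h.prob μ hμ
  refine ⟨by fun_prop, ?_⟩
  rw [hasFiniteIntegral_iff_ofReal (.of_forall fun t => by positivity)]
  exact (h.decay μ hμ).trans_lt ENNReal.ofReal_lt_top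

lemma integral_norm_charFun_pow_le (h : UniformLocalClass 𝓒 a C N) (hμ : μ ∈ 𝓒) :
    ∫ t, ‖charFun μ t‖ ^ N ≤ max C 0 := by
  rw [← ENNReal.ofReal_le_ofReal_iff (le_max_right _ _), ofReal_integral_eq_lintegral_ofReal
    (h.integrable_norm_charFun_pow hμ) (.of_forall fun t => by positivity)]
  exact (h.decay μ hμ).trans (ENNReal.ofReal_le_ofReal (le_max_left _ _))

lemma integrable_charFun_pow (h : UniformLocalClass 𝓒 a C N) (hμ : μ ∈ 𝓒) {m : ℕ} (hm : N ≤ m) :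
    Integrable fun t => charFun μ t ^ m := by
  have := h.prob μ hμ
  refine (h.integrable_norm_charFun_pow hμ).mono' (by fun_prop) (.of_forall fun t => ?_)
  rw [norm_pow]
  exact pow_le_pow_of_le_one (norm_nonneg _) (norm_charFun_le_one t) hm

lemma exists_sqrt_mul_integral_norm_sub_gaussian_le (h : UniformLocalClass 𝓒 a C N) (hε : 0 < ε) :
    ∃ M : ℕ, 2 ≤ M ∧ N ≤ M ∧ ∀ m : ℕ, M ≤ m → ∀ μ ∈ 𝓒,
      √(m * (∫ x, x ^ 2 ∂μ) / (2 * Real.pi)) *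
        ∫ t, ‖charFun μ t ^ m - (Real.exp (-(m * (∫ x, x ^ 2 ∂μ) * t ^ 2 / 2)) : ℝ)‖ ≤ ε := by
  have ha := h.pos
  obtain ⟨b, -, hb⟩ := h.exists_var_le
  obtain ⟨δ, hδ, hnear⟩ := h.exists_pos_norm_charFun_sub_gaussian_le (ε := ε * a / 128)
    (by positivity)
  obtain ⟨q, hq0, hq1, hfar⟩ := h.exists_norm_charFun_le hδ
  have hfar_small : Tendsto (fun m : ℕ => √b * (m * q ^ (m - N)) * max C 0 +
      2 * Real.exp (-(m * (a * δ ^ 2 / 4)))) atTop (𝓝 0) := by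
    have hexp : Tendsto (fun m : ℕ => (m : ℝ) * (a * δ ^ 2 / 4)) atTop atTop :=
      tendsto_natCast_atTop_atTop.atTop_mul_const (by positivity)
    simpa using (((tendsto_natCast_mul_pow_sub hq0 hq1 N).const_mul (√b)).mul_const (max C 0)).add
      ((Real.tendsto_exp_neg_atTop_nhds_zero.comp hexp).const_mul 2)
  obtain ⟨M, hM⟩ := eventually_atTop.1 (hfar_small.eventually_le_const (half_pos hε))
  refine ⟨max (max 2 N) M, by simp, by simp, fun m hm μ hμ => ?_⟩
  obtain ⟨hm2, hNm, hMm⟩ : 2 ≤ m ∧ N ≤ m ∧ M ≤ m := by simpa using hm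
  have hav := h.le_var μ hμ
  have hbound := sqrt_mul_integral_norm_pow_sub_gaussian_le (ha.trans_le hav) hδ.le
    (by positivity) (hnear μ hμ) (hfar μ hμ) (h.integrable_norm_charFun_pow hμ) hm2 hNm
  set v := ∫ x, x ^ 2 ∂μ
  have hweight := sqrt_mul_div_two_pi_le (ha.trans_le hav).le (hb μ hμ) m
  calc _ ≤ 64 * (ε * a / 128) / v + √(m * v / (2 * Real.pi)) *
          (q ^ (m - N) * ∫ t, ‖charFun μ t‖ ^ N) + 2 * Real.exp (-(m * (v * δ ^ 2 / 4))) := hbound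
    _ ≤ 64 * (ε * a / 128) / a + √b * m * (q ^ (m - N) * max C 0) +
          2 * Real.exp (-(m * (a * δ ^ 2 / 4))) := by
        gcongr
        exact h.integral_norm_charFun_pow_le hμ
    _ = ε / 2 + (√b * (m * q ^ (m - N)) * max C 0 + 2 * Real.exp (-(m * (a * δ ^ 2 / 4)))) := by
        field_simp
        ring
    _ ≤ ε / 2 + ε / 2 := by
        gcongr
        exact hM m hMm
    _ = ε := add_halves ε

theorem exists_norm_sqrt_mul_inversionIntegral_sub_gaussian_le (h : UniformLocalClass 𝓒 a C N)
    (hε : 0 < ε) :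
    ∃ M : ℕ, N ≤ M ∧ ∀ m : ℕ, M ≤ m → ∀ μ ∈ 𝓒, ∀ s : ℝ,
      ‖((√(2 * Real.pi * (m * ∫ x, x ^ 2 ∂μ)) : ℝ) : ℂ) *
          inversionIntegral (fun t => charFun μ t ^ m) s -
        (Real.exp (-s ^ 2 / (2 * (m * ∫ x, x ^ 2 ∂μ))) : ℝ)‖ ≤ ε := by
  obtain ⟨M, hM2, hMN, hM⟩ := h.exists_sqrt_mul_integral_norm_sub_gaussian_le hε
  refine ⟨M, hMN, fun m hm μ hμ s => (?_ : _ ≤ _).trans (hM m hm μ hμ)⟩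
  have hv := h.pos.trans_le (h.le_var μ hμ)
  have hcharFun := h.integrable_charFun_pow hμ (hMN.trans hm)
  set v := ∫ x, x ^ 2 ∂μ
  have hmv : 0 < m * v := mul_pos (by exact_mod_cast (by omega : 0 < m)) hv
  have hgauss : Integrable fun t : ℝ => ((Real.exp (-(m * v * t ^ 2 / 2)) : ℝ) : ℂ) := by
    have : Integrable fun t : ℝ => Real.exp (-(m * v * t ^ 2 / 2)) := by
      simpa only [neg_mul, div_mul_eq_mul_div] using integrable_exp_neg_mul_sq (half_pos hmv)
    exact this.ofReal
  rw [← inversionIntegral_gaussian hmv, ← mul_sub, ← inversionIntegral_sub hcharFun hgauss,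
    norm_mul, Complex.norm_real, Real.norm_of_nonneg (Real.sqrt_nonneg _)]
  calc _ ≤ √(2 * Real.pi * (m * v)) * ((2 * Real.pi)⁻¹ *
          ∫ t, ‖charFun μ t ^ m - (Real.exp (-(m * v * t ^ 2 / 2)) : ℝ)‖) := by
        gcongr
        exact norm_inversionIntegral_le _ _
    _ = _ := by
        rw [← mul_assoc, show m * v / (2 * Real.pi) = 2 * Real.pi * (m * v) / (2 * Real.pi) ^ 2 by
          field_simp, Real.sqrt_div' _ (by positivity), Real.sqrt_sq (by positivity),
          div_eq_mul_inv]

end UniformLocalClass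

section Stirling

/-- The ratio of `Γ(x)` to its Stirling approximation `√(2π / x) (x / e) ^ x`. -/
noncomputable def stirlingRatio (x : ℝ) : ℝ :=
  Real.Gamma x * √(x / (2 * Real.pi)) * Real.exp x / x ^ x

lemma stirlingRatio_natCast {j : ℕ} (hj : j ≠ 0) :
    stirlingRatio j = Stirling.stirlingSeq j / √Real.pi := by
  have hj_pos : (0 : ℝ) < j := by exact_mod_cast Nat.pos_of_ne_zero hj
  have hsqrt : √((j : ℝ) / (2 * Real.pi)) = j / √Real.pi / √(2 * (j : ℝ)) := by
    rw [eq_div_iff (by positivity), ← Real.sqrt_mul (by positivity),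
      show (j : ℝ) / (2 * Real.pi) * (2 * j) = j ^ 2 / Real.pi by field_simp,
      Real.sqrt_div (by positivity), Real.sqrt_sq hj_pos.le]
  have hGamma : (j.factorial : ℝ) = j * Real.Gamma j := by
    rw [← Real.Gamma_nat_eq_factorial, Real.Gamma_add_one hj_pos.ne']
  rw [stirlingRatio, Stirling.stirlingSeq, hGamma, hsqrt, Real.rpow_natCast, div_pow,
    ← Real.exp_nat_mul, mul_one]
  field_simp

lemma tendsto_stirlingRatio_natCast : Tendsto (fun j : ℕ => stirlingRatio j) atTop (𝓝 1) := by
  have h := Stirling.tendsto_stirlingSeq_sqrt_pi.div_const √Real.pi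
  rw [div_self (Real.sqrt_pos.2 Real.pi_pos).ne'] at h
  refine h.congr' ?_
  filter_upwards [eventually_ne_atTop 0] with j hj
  exact (stirlingRatio_natCast hj).symm

lemma add_half_rpow_add_half {x : ℝ} (hx : 0 < x) :
    (x + 1 / 2) ^ (x + 1 / 2) = x ^ x * (1 + 1 / 2 / x) ^ x * √(x + 1 / 2) := by
  rw [Real.rpow_add (by positivity), ← Real.sqrt_eq_rpow,
    ← Real.mul_rpow hx.le (by positivity)]
  congr 2
  field_simp

lemma sqrt_mul_sqrt_add_half {x : ℝ} (hx : 0 < x) :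
    √(x / (2 * Real.pi)) * √((x + 1 / 2) / (2 * Real.pi)) * (2 * √Real.pi) =
      √(2 * x / (2 * Real.pi)) * √(x + 1 / 2) := by
  have htwo : 2 * √Real.pi = √(2 ^ 2 * Real.pi) := by
    rw [Real.sqrt_mul (by positivity), Real.sqrt_sq two_pos.le]
  rw [htwo, ← Real.sqrt_mul (by positivity), ← Real.sqrt_mul (by positivity),
    ← Real.sqrt_mul (by positivity)]
  congr 1
  field_simp

lemma stirlingRatio_mul_stirlingRatio_add_half {x : ℝ} (hx : 0 < x) :
    stirlingRatio x * stirlingRatio (x + 1 / 2) =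
      stirlingRatio (2 * x) * (Real.exp (1 / 2) / (1 + 1 / 2 / x) ^ x) := by
  have hpow : (2 * x) ^ (2 * x) = (2 : ℝ) ^ (2 * x) * (x ^ x * x ^ x) := by
    rw [Real.mul_rpow two_pos.le hx.le, ← Real.rpow_add hx, two_mul x]
  have hduplication : Real.Gamma x * Real.Gamma (x + 1 / 2) =
      Real.Gamma (2 * x) * (2 / 2 ^ (2 * x)) * √Real.pi := by
    rw [Real.Gamma_mul_Gamma_add_half, Real.rpow_sub two_pos, Real.rpow_one]
  have hexp : Real.exp x * Real.exp (x + 1 / 2) = Real.exp (2 * x) * Real.exp (1 / 2) := by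
    rw [← Real.exp_add, ← Real.exp_add]
    ring_nf
  calc stirlingRatio x * stirlingRatio (x + 1 / 2)
      = (Real.Gamma x * Real.Gamma (x + 1 / 2)) *
          (√(x / (2 * Real.pi)) * √((x + 1 / 2) / (2 * Real.pi))) *
          (Real.exp x * Real.exp (x + 1 / 2)) / (x ^ x * (x + 1 / 2) ^ (x + 1 / 2)) := by
        rw [stirlingRatio, stirlingRatio]
        ring
    _ = Real.Gamma (2 * x) *
          (√(x / (2 * Real.pi)) * √((x + 1 / 2) / (2 * Real.pi)) * (2 * √Real.pi)) *
          (Real.exp (2 * x) * Real.exp (1 / 2)) /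
          ((2 * x) ^ (2 * x) * (1 + 1 / 2 / x) ^ x * √(x + 1 / 2)) := by
        rw [hduplication, hexp, hpow, add_half_rpow_add_half hx]
        field_simp
    _ = stirlingRatio (2 * x) * (Real.exp (1 / 2) / (1 + 1 / 2 / x) ^ x) := by
        rw [sqrt_mul_sqrt_add_half hx, stirlingRatio]
        field_simp

lemma tendsto_stirlingRatio_add_half :
    Tendsto (fun j : ℕ => stirlingRatio (j + 1 / 2)) atTop (𝓝 1) := by
  have hnat := tendsto_stirlingRatio_natCast
  have heven : Tendsto (fun j : ℕ => stirlingRatio ((2 * j : ℕ) : ℝ)) atTop (𝓝 1) :=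
    hnat.comp (tendsto_id.const_mul_atTop' two_pos)
  have hlim := (heven.mul ((tendsto_const_nhds (x := Real.exp (1 / 2))).div
    (Real.tendsto_one_add_div_pow_exp (1 / 2)) (Real.exp_pos _).ne')).div hnat one_ne_zero
  rw [div_self (Real.exp_pos _).ne', div_one, one_mul] at hlim
  refine hlim.congr' ?_
  filter_upwards [eventually_gt_atTop 0, hnat.eventually_ne one_ne_zero] with j hj hne
  have hj_pos : (0 : ℝ) < j := by exact_mod_cast hj
  rw [Pi.div_apply, div_eq_iff hne, mul_comm (stirlingRatio (j + 1 / 2)),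
    stirlingRatio_mul_stirlingRatio_add_half hj_pos, Pi.div_apply, Real.rpow_natCast]
  push_cast
  rfl

lemma tendsto_stirlingRatio_half :
    Tendsto (fun n : ℕ => stirlingRatio ((n : ℝ) / 2)) atTop (𝓝 1) := by
  refine tendsto_def.2 fun s hs => ?_
  obtain ⟨J, hJ⟩ := eventually_atTop.1
    ((tendsto_stirlingRatio_natCast.eventually_mem hs).and
      (tendsto_stirlingRatio_add_half.eventually_mem hs))
  refine mem_atTop_sets.2 ⟨2 * J, fun n hn => ?_⟩
  rw [Set.mem_preimage]
  rcases Nat.even_or_odd' n with ⟨j, rfl | rfl⟩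
  · convert (hJ j (by omega)).1 using 2
    push_cast
    ring
  · convert (hJ j (by omega)).2 using 2
    push_cast
    ring

end Stirling

lemma withDensity_energyDensity_eq_map {E : Type*} [NormedAddCommGroup E] [InnerProductSpace ℝ E]
    [FiniteDimensional ℝ E] [MeasurableSpace E] [BorelSpace E] [Nontrivial E] {f : E → ℝ}
    (hf : Measurable f) :
    volume.withDensity (energyDensity f) =
      (volume.withDensity fun v => ENNReal.ofReal (f v)).map (fun v => ‖v‖ ^ 2) := by
  have hnorm : Measurable fun v : E => ‖v‖ ^ 2 := by fun_prop
  ext s hs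
  have : Measurable (s.indicator (1 : ℝ → ℝ≥0∞)) := measurable_one.indicator hs
  have hdensity (u : ℝ) : radialDensity
      (fun v : E => s.indicator 1 (‖v‖ ^ 2) * ENNReal.ofReal (f v)) u =
      s.indicator (energyDensity f) u := by
    rw [radialDensity_norm_sq (fun u v => s.indicator 1 u * ENNReal.ofReal (f v)),
      radialDensity_const_mul _ (by fun_prop), energyDensity]
    by_cases hu : u ∈ s <;> simp [hu]
  rw [Measure.map_apply hnorm hs, withDensity_apply _ (hnorm hs), withDensity_apply _ hs,
    ← lintegral_indicator hs, ← lintegral_indicator (hnorm hs)]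
  simp_rw [← hdensity]
  rw [← lintegral_eq_lintegral_radialDensity (by fun_prop)]
  refine lintegral_congr fun v => ?_
  by_cases hv : ‖v‖ ^ 2 ∈ s <;> simp [Set.indicator, hv]

section CenteredEnergyLaw

variable {k : ℕ} {f : EuclideanSpace ℝ (Fin k) → ℝ}

/-- The law of `‖v‖ ^ 2 - energy f` when `v` has density `f`, so that the energies of independent
particles are sums of independent variables with this law, up to a translation. -/
noncomputable def centeredEnergyLaw (f : EuclideanSpace ℝ (Fin k) → ℝ) : Measure ℝ :=
  (volume.withDensity fun v => ENNReal.ofReal (f v)).map fun v => ‖v‖ ^ 2 - energy f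

lemma integrable_centeredEnergyLaw_iff (hf : Measurable f) (hf0 : ∀ v, 0 ≤ f v) {g : ℝ → ℝ}
    (hg : Measurable g) :
    Integrable g (centeredEnergyLaw f) ↔
      Integrable fun v => g (‖v‖ ^ 2 - energy f) * f v := by
  rw [centeredEnergyLaw, integrable_map_measure hg.aestronglyMeasurable (by fun_prop),
    integrable_withDensity_iff hf.ennreal_ofReal (.of_forall fun v => ENNReal.ofReal_lt_top)]
  simp only [Function.comp_apply, ENNReal.toReal_ofReal (hf0 _)]

lemma setIntegral_centeredEnergyLaw (hf : Measurable f) (hf0 : ∀ v, 0 ≤ f v) {g : ℝ → ℝ}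
    (hg : Measurable g) {s : Set ℝ} (hs : MeasurableSet s) :
    ∫ x in s, g x ∂(centeredEnergyLaw f) =
      ∫ v in {v | ‖v‖ ^ 2 - energy f ∈ s}, g (‖v‖ ^ 2 - energy f) * f v := by
  have hmap : Measurable fun v : EuclideanSpace ℝ (Fin k) => ‖v‖ ^ 2 - energy f := by fun_prop
  rw [centeredEnergyLaw, setIntegral_map hs hg.aestronglyMeasurable hmap.aemeasurable,
    setIntegral_withDensity_eq_setIntegral_toReal_smul hf.ennreal_ofReal
      (.of_forall fun v => ENNReal.ofReal_lt_top) _ (hmap hs)]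
  simp only [ENNReal.toReal_ofReal (hf0 _), smul_eq_mul, mul_comm (f _)]
  rfl

lemma integral_centeredEnergyLaw (hf : Measurable f) (hf0 : ∀ v, 0 ≤ f v) {g : ℝ → ℝ}
    (hg : Measurable g) :
    ∫ x, g x ∂(centeredEnergyLaw f) = ∫ v, g (‖v‖ ^ 2 - energy f) * f v := by
  simpa using setIntegral_centeredEnergyLaw hf hf0 hg MeasurableSet.univ

lemma charFun_withDensity_energyDensity [NeZero k] (hf : Measurable f) (t : ℝ) :
    charFun (volume.withDensity (energyDensity f)) t =
      Complex.exp (t * energy f * Complex.I) * charFun (centeredEnergyLaw f) t := by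
  have htranslate : volume.withDensity (energyDensity f) =
      (centeredEnergyLaw f).map (fun x => x + energy f) := by
    rw [withDensity_energyDensity_eq_map hf, centeredEnergyLaw,
      Measure.map_map (by fun_prop) (by fun_prop)]
    simp only [Function.comp_def, sub_add_cancel]
  rw [htranslate, charFun_map_add_const, mul_comm]
  simp

lemma norm_charFun_withDensity_energyDensity [NeZero k] (hf : Measurable f) (t : ℝ) :
    ‖charFun (volume.withDensity (energyDensity f)) t‖ = ‖charFun (centeredEnergyLaw f) t‖ := by
  rw [charFun_withDensity_energyDensity hf, norm_mul, ← Complex.ofReal_mul,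
    Complex.norm_exp_ofReal_mul_I, one_mul]

end CenteredEnergyLaw

namespace IsProbDensity

variable {k : ℕ} {f : EuclideanSpace ℝ (Fin k) → ℝ}

lemma integrable (hf : IsProbDensity f) : Integrable f := by
  refine ⟨hf.measurable.aestronglyMeasurable, ?_⟩
  rw [hasFiniteIntegral_iff_ofReal (.of_forall hf.nonneg), hf.lintegral_eq_one]
  exact ENNReal.one_lt_top

lemma integral_eq_one (hf : IsProbDensity f) : ∫ v, f v = 1 := by
  rw [integral_eq_lintegral_of_nonneg_ae (.of_forall hf.nonneg)
    hf.measurable.aestronglyMeasurable, hf.lintegral_eq_one, ENNReal.toReal_one]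

lemma energy_nonneg (hf : IsProbDensity f) : 0 ≤ energy f :=
  integral_nonneg fun v => mul_nonneg (sq_nonneg _) (hf.nonneg v)

lemma isProbabilityMeasure_centeredEnergyLaw (hf : IsProbDensity f) :
    IsProbabilityMeasure (centeredEnergyLaw f) := by
  have : IsProbabilityMeasure (volume.withDensity fun v => ENNReal.ofReal (f v)) :=
    ⟨by simp [hf.lintegral_eq_one]⟩
  exact Measure.isProbabilityMeasure_map (by fun_prop)

lemma integrable_norm_sq_mul (hf : IsProbDensity f)
    (hfourth : Integrable fun v => ‖v‖ ^ 4 * f v) : Integrable fun v => ‖v‖ ^ 2 * f v := by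
  have hmeas := hf.measurable
  refine (hfourth.add hf.integrable).mono' (by fun_prop) (.of_forall fun v => ?_)
  have hf0 := hf.nonneg v
  rw [Real.norm_of_nonneg (by positivity)]
  calc ‖v‖ ^ 2 * f v ≤ (‖v‖ ^ 4 + 1) * f v := by
        gcongr
        nlinarith [sq_nonneg (‖v‖ ^ 2 - 1)]
    _ = ‖v‖ ^ 4 * f v + f v := by ring

lemma integrable_sq_centeredEnergyLaw (hf : IsProbDensity f)
    (hfourth : Integrable fun v => ‖v‖ ^ 4 * f v) :
    Integrable (fun x => x ^ 2) (centeredEnergyLaw f) := by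
  rw [integrable_centeredEnergyLaw_iff hf.measurable hf.nonneg (by fun_prop)]
  refine ((hfourth.sub ((hf.integrable_norm_sq_mul hfourth).const_mul (2 * energy f))).add
    (hf.integrable.const_mul (energy f ^ 2))).congr (.of_forall fun v => ?_)
  simp only [Pi.add_apply, Pi.sub_apply]
  ring

lemma integral_id_centeredEnergyLaw (hf : IsProbDensity f)
    (hfourth : Integrable fun v => ‖v‖ ^ 4 * f v) : ∫ x, x ∂(centeredEnergyLaw f) = 0 := by
  rw [integral_centeredEnergyLaw (g := fun x => x) hf.measurable hf.nonneg measurable_id]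
  simp only [sub_mul]
  rw [integral_sub (hf.integrable_norm_sq_mul hfourth) (hf.integrable.const_mul _),
    integral_const_mul, hf.integral_eq_one, mul_one, energy, sub_self]

lemma integral_sq_centeredEnergyLaw (hf : IsProbDensity f) :
    ∫ x, x ^ 2 ∂(centeredEnergyLaw f) = energyDev f ^ 2 := by
  rw [energyDev, Real.sq_sqrt (integral_nonneg fun v => mul_nonneg (sq_nonneg _) (hf.nonneg v)),
    integral_centeredEnergyLaw hf.measurable hf.nonneg (by fun_prop)]

/- Since `0 ≤ energy f ≤ R`, the energy can deviate from its mean by more than `R` only upwards. -/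
lemma setIntegral_sq_centeredEnergyLaw_le (hf : IsProbDensity f)
    (hfourth : Integrable fun v => ‖v‖ ^ 4 * f v) {R : ℝ} (hR : energy f ≤ R) :
    ∫ x in {x | R < |x|}, x ^ 2 ∂(centeredEnergyLaw f) ≤
      ∫ v in {v | R ≤ ‖v‖ ^ 2}, ‖v‖ ^ 4 * f v := by
  have hE := hf.energy_nonneg
  have hs : MeasurableSet {x : ℝ | R < |x|} := measurableSet_lt (by fun_prop) (by fun_prop)
  have hs_energy : MeasurableSet {v : EuclideanSpace ℝ (Fin k) | R < |‖v‖ ^ 2 - energy f|} :=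
    measurableSet_lt (by fun_prop) (by fun_prop)
  have hupward (v : EuclideanSpace ℝ (Fin k)) (hv : R < |‖v‖ ^ 2 - energy f|) :
      0 ≤ ‖v‖ ^ 2 - energy f ∧ R ≤ ‖v‖ ^ 2 := by
    rcases lt_abs.1 hv with h | h <;> constructor <;> nlinarith [sq_nonneg ‖v‖]
  have hfourth_nonneg (v : EuclideanSpace ℝ (Fin k)) : 0 ≤ ‖v‖ ^ 4 * f v :=
    mul_nonneg (by positivity) (hf.nonneg v)
  rw [setIntegral_centeredEnergyLaw hf.measurable hf.nonneg (by fun_prop) hs]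
  calc ∫ v in {v | R < |‖v‖ ^ 2 - energy f|}, (‖v‖ ^ 2 - energy f) ^ 2 * f v
      ≤ ∫ v in {v | R < |‖v‖ ^ 2 - energy f|}, ‖v‖ ^ 4 * f v := by
        refine integral_mono_of_nonneg (.of_forall fun v => mul_nonneg (sq_nonneg _) (hf.nonneg v))
          hfourth.integrableOn ?_
        filter_upwards [ae_restrict_mem hs_energy] with v hv
        have hf0 := hf.nonneg v
        calc (‖v‖ ^ 2 - energy f) ^ 2 * f v ≤ (‖v‖ ^ 2) ^ 2 * f v := by
              gcongr
              · exact (hupward v hv).1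
              · linarith
          _ = ‖v‖ ^ 4 * f v := by ring
    _ ≤ ∫ v in {v | R ≤ ‖v‖ ^ 2}, ‖v‖ ^ 4 * f v :=
        setIntegral_mono_set hfourth.integrableOn (.of_forall hfourth_nonneg)
          (.of_forall fun v hv => (hupward v hv).2)

end IsProbDensity

section TotalEnergy

variable {k : ℕ} [NeZero k] {f : EuclideanSpace ℝ (Fin k) → ℝ}

lemma charFun_totalEnergyDensity (hf : IsProbDensity f) (m : ℕ) [NeZero m] :
    IsProbabilityMeasure (volume.withDensity (totalEnergyDensity f m)) ∧
      ∀ t, charFun (volume.withDensity (totalEnergyDensity f m)) t =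
        charFun (volume.withDensity (energyDensity f)) t ^ m := by
  have hone : IsProbabilityMeasure (volume.withDensity (energyDensity f)) :=
    ⟨by simp [lintegral_energyDensity hf.measurable, hf.lintegral_eq_one]⟩
  obtain ⟨m, rfl⟩ := Nat.exists_eq_succ_of_ne_zero (NeZero.ne m)
  induction m with
  | zero => simpa [totalEnergyDensity_one hf.measurable] using hone
  | succ m ih =>
    obtain ⟨hprob, hchar⟩ := ih
    rw [totalEnergyDensity_succ hf.measurable hf.nonneg (m + 1),
      ← conv_withDensity_eq_lconvolution (measurable_energyDensity hf.measurable)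
        (measurable_totalEnergyDensity hf.measurable (m + 1))]
    exact ⟨inferInstance, fun t => by rw [charFun_conv, hchar, pow_succ' _ (m + 1)]⟩

lemma totalEnergyDensity_succ_eq_inversionIntegral (hf : IsProbDensity f) {m : ℕ} [NeZero m]
    (hint : Integrable fun t => charFun (centeredEnergyLaw f) t ^ m) (s : ℝ) :
    totalEnergyDensity f (m + 1) s ≠ ∞ ∧ ((totalEnergyDensity f (m + 1) s).toReal : ℂ) =
      inversionIntegral (fun t => charFun (centeredEnergyLaw f) t ^ (m + 1))
        (s - (m + 1 : ℕ) * energy f) := by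
  obtain ⟨hprob, hchar⟩ := charFun_totalEnergyDensity hf m
  have hmass_one : ∫⁻ x, energyDensity f x ≠ ∞ := by
    rw [lintegral_energyDensity hf.measurable, hf.lintegral_eq_one]
    exact ENNReal.one_ne_top
  have hmass : ∫⁻ x, totalEnergyDensity f m x ≠ ∞ := by
    rw [← setLIntegral_univ, ← withDensity_apply _ MeasurableSet.univ]
    exact measure_ne_top _ _
  have hint_total : Integrable (charFun (volume.withDensity (totalEnergyDensity f m))) :=
    hint.congr' (by fun_prop) (.of_forall fun t => by
      rw [hchar, norm_pow, norm_pow, norm_charFun_withDensity_energyDensity hf.measurable])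
  have hphase (t : ℝ) : Complex.exp (t * ((m + 1 : ℕ) * energy f : ℝ) * Complex.I) *
      charFun (centeredEnergyLaw f) t ^ (m + 1) =
        charFun (volume.withDensity (energyDensity f)) t *
          charFun (volume.withDensity (totalEnergyDensity f m)) t := by
    rw [hchar, ← pow_succ', charFun_withDensity_energyDensity hf.measurable, mul_pow,
      ← Complex.exp_nat_mul]
    congr 2
    push_cast
    ring
  rw [← inversionIntegral_exp_mul, totalEnergyDensity_succ hf.measurable hf.nonneg m]
  simp only [hphase]
  exact lconvolution_eq_inversionIntegral (measurable_energyDensity hf.measurable)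
    (measurable_totalEnergyDensity hf.measurable m) hmass_one hmass hint_total s

end TotalEnergy

/-- The densities to which the local limit theorem applies uniformly; only the bounds, and not the
density itself, may enter the rate of convergence. -/
structure IsAdmissible {k : ℕ} (Emax Smin p L : ℝ) (χ : ℝ → ℝ)
    (f : EuclideanSpace ℝ (Fin k) → ℝ) : Prop where
  isProbDensity : IsProbDensity f
  integrable : Integrable fun v => ‖v‖ ^ 4 * f v
  energy_le : energy f ≤ Emax
  le_energyDev : Smin ≤ energyDev f
  eLpNorm_le : eLpNorm f (ENNReal.ofReal p) volume ≤ ENNReal.ofReal L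
  tail : ∀ s : ℝ, 0 < s → ∫ v in {v | 1 / s ≤ ‖v‖}, ‖v‖ ^ 4 * f v ≤ χ s

namespace IsAdmissible

variable {k : ℕ} {f : EuclideanSpace ℝ (Fin k) → ℝ} {Emax Smin p L : ℝ} {χ : ℝ → ℝ}

lemma lintegral_rpow_le (hf : IsAdmissible Emax Smin p L χ f) (hp : 0 < p) :
    ∫⁻ v, ENNReal.ofReal (f v ^ p) ≤ (L.toNNReal ^ p : ℝ≥0) := by
  have hnorm := eLpNorm_nnreal_pow_eq_lintegral (f := f) (μ := volume)
    (Real.toNNReal_pos.2 hp).ne'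
  rw [Real.coe_toNNReal p hp.le] at hnorm
  calc ∫⁻ v, ENNReal.ofReal (f v ^ p) = ∫⁻ v, ‖f v‖ₑ ^ p := by
        refine lintegral_congr fun v => ?_
        rw [Real.enorm_of_nonneg (hf.isProbDensity.nonneg v),
          ENNReal.ofReal_rpow_of_nonneg (hf.isProbDensity.nonneg v) hp.le]
    _ = eLpNorm f (ENNReal.ofReal p) volume ^ p := hnorm.symm
    _ ≤ ENNReal.ofReal L ^ p := ENNReal.rpow_le_rpow hf.eLpNorm_le hp.le
    _ = (L.toNNReal ^ p : ℝ≥0) := (ENNReal.coe_rpow_of_nonneg _ hp.le).symm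

lemma lintegral_energy_le (hf : IsAdmissible Emax Smin p L χ f) :
    ∫⁻ v, ENNReal.ofReal (‖v‖ ^ 2 * f v) ≤ Emax.toNNReal := by
  rw [← ofReal_integral_eq_lintegral_ofReal
    (hf.isProbDensity.integrable_norm_sq_mul hf.integrable)
    (.of_forall fun v => mul_nonneg (sq_nonneg _) (hf.isProbDensity.nonneg v))]
  exact ENNReal.ofReal_le_ofReal hf.energy_le

lemma setIntegral_sq_centeredEnergyLaw_le (hf : IsAdmissible Emax Smin p L χ f) {s : ℝ}
    (hs : 0 < s) (hsE : Emax ≤ (1 / s) ^ 2) :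
    ∫ x in {x | (1 / s) ^ 2 < |x|}, x ^ 2 ∂(centeredEnergyLaw f) ≤ χ s := by
  have hset : {v : EuclideanSpace ℝ (Fin k) | (1 / s) ^ 2 ≤ ‖v‖ ^ 2} = {v | 1 / s ≤ ‖v‖} := by
    ext v
    exact pow_le_pow_iff_left₀ (by positivity) (norm_nonneg v) two_ne_zero
  have htail := hf.isProbDensity.setIntegral_sq_centeredEnergyLaw_le hf.integrable
    (hf.energy_le.trans hsE)
  rw [hset] at htail
  exact htail.trans (hf.tail s hs)

end IsAdmissible

/-- The centred energy laws of the admissible densities, to which the uniform local limit theorem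
is applied. -/
def centeredEnergyLaws (k : ℕ) (Emax Smin p L : ℝ) (χ : ℝ → ℝ) : Set (Measure ℝ) :=
  centeredEnergyLaw '' {f : EuclideanSpace ℝ (Fin k) → ℝ | IsAdmissible Emax Smin p L χ f}

section UniformLocalClass

variable {k : ℕ} {Emax Smin p L : ℝ} {χ : ℝ → ℝ}

lemma exists_tail_centeredEnergyLaws_le (hχ : Tendsto χ (𝓝[>] (0 : ℝ)) (𝓝 0)) {ε : ℝ}
    (hε : 0 < ε) :
    ∃ R : ℝ, 0 ≤ R ∧ ∀ μ ∈ centeredEnergyLaws k Emax Smin p L χ,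
      ∫ x in {x | R < |x|}, x ^ 2 ∂μ ≤ ε := by
  have hinv : Tendsto (fun s : ℝ => (1 / s) ^ 2) (𝓝[>] 0) atTop := by
    simp only [one_div]
    exact (tendsto_pow_atTop two_ne_zero).comp tendsto_inv_nhdsGT_zero
  obtain ⟨s, ⟨hχs, hsE⟩, hs⟩ := (((hχ.eventually_le_const hε).and
    (hinv.eventually_ge_atTop Emax)).and self_mem_nhdsWithin).exists
  refine ⟨(1 / s) ^ 2, by positivity, ?_⟩
  rintro _ ⟨f, hf, rfl⟩
  exact (hf.setIntegral_sq_centeredEnergyLaw_le hs hsE).trans hχs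

theorem exists_uniformLocalClass_centeredEnergyLaws [NeZero k] (hSmin : 0 < Smin) (hp : 1 < p)
    (hχ : Tendsto χ (𝓝[>] (0 : ℝ)) (𝓝 0)) :
    ∃ C N, UniformLocalClass (centeredEnergyLaws k Emax Smin p L χ) (Smin ^ 2) C N := by
  obtain ⟨N, C, hdecay⟩ := exists_lintegral_norm_charFun_energyDensity_pow_le
    (EuclideanSpace ℝ (Fin k)) hp (L.toNNReal ^ p) Emax.toNNReal
  refine ⟨C, N, ?_⟩
  constructor
  case pos => positivity
  case tail => exact fun ε hε => exists_tail_centeredEnergyLaws_le hχ hε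
  all_goals rintro _ ⟨f, hf, rfl⟩
  case prob => exact hf.isProbDensity.isProbabilityMeasure_centeredEnergyLaw
  case sq_integrable => exact hf.isProbDensity.integrable_sq_centeredEnergyLaw hf.integrable
  case integral_eq_zero => exact hf.isProbDensity.integral_id_centeredEnergyLaw hf.integrable
  case le_var =>
    rw [hf.isProbDensity.integral_sq_centeredEnergyLaw]
    gcongr
    exact hf.le_energyDev
  case decay =>
    simpa only [norm_charFun_withDensity_energyDensity hf.isProbDensity.measurable] using
      hdecay f hf.isProbDensity.measurable hf.isProbDensity.lintegral_eq_one
        (hf.lintegral_rpow_le (one_pos.trans hp)) hf.lintegral_energy_le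

end UniformLocalClass

section Algebra

lemma abs_mul_sub_le_of_abs_sub_one_le {ρ x g ε : ℝ} (hρ_one : |ρ - 1| ≤ 1)
    (hρ : |ρ - 1| ≤ ε / 2) (hx : |x - g| ≤ ε / 4) (hg : |g| ≤ 1) : |ρ * x - g| ≤ ε := by
  have hρ_two : |ρ| ≤ 2 := by
    rw [abs_le] at hρ_one ⊢
    constructor <;> linarith
  calc |ρ * x - g| = |ρ * (x - g) + (ρ - 1) * g| := by
        congr 1
        ring
    _ ≤ |ρ| * |x - g| + |ρ - 1| * |g| := by
        rw [← abs_mul, ← abs_mul]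
        exact abs_add_le _ _
    _ ≤ 2 * (ε / 4) + ε / 2 * 1 := by
        gcongr
        exact (abs_nonneg _).trans hρ
    _ = ε := by ring

lemma exists_tendsto_zero_of_eventually_abs_le {ι : Type*} (d : ℕ → ι → ℝ)
    (h : ∀ ε > 0, ∀ᶠ m in atTop, ∀ i, |d m i| ≤ ε) :
    ∃ ω : ℕ → ℝ, Tendsto ω atTop (𝓝 0) ∧ ∀ᶠ m in atTop, ∀ i, |d m i| ≤ ω m := by
  refine ⟨fun m => ⨆ i, |d m i|, Metric.tendsto_nhds.2 fun ε hε => ?_, ?_⟩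
  · filter_upwards [h (ε / 2) (half_pos hε)] with m hm
    rw [dist_zero_right, Real.norm_of_nonneg (Real.iSup_nonneg fun i => abs_nonneg _)]
    exact (Real.iSup_le hm (half_pos hε).le).trans_lt (half_lt_self hε)
  · filter_upwards [h 1 one_pos] with m hm i
    exact le_ciSup (f := fun i => |d m i|) ⟨1, Set.forall_mem_range.2 hm⟩ i

end Algebra

section LeadingFactor

lemma alpha_pos (n : ℕ) {s : ℝ} (hs : 0 < s) : 0 < alpha n s := by
  unfold alpha
  positivity

lemma gaussianOnSphere_mul_alpha_div_alpha {n : ℕ} (hn : n ≠ 0) {r : ℝ} (hr : 0 < r) :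
    gaussianOnSphere n r * (alpha n n / alpha n (r ^ 2)) *
      (stirlingRatio ((n : ℝ) / 2) * √(4 * Real.pi * n)) =
    Real.Gamma ((n : ℝ) / 2) /
      (Real.pi ^ ((n : ℝ) / 2) * (r ^ 2) ^ ((n : ℝ) / 2 - 1)) := by
  obtain ⟨x, hx⟩ : ∃ x : ℝ, (n : ℝ) / 2 = x := ⟨_, rfl⟩
  have hn_eq : (n : ℝ) = 2 * x := by linarith
  have hx_pos : 0 < x := by
    rw [← hx]
    positivity
  have hsqrt : √(x / (2 * Real.pi)) * √(4 * Real.pi * (2 * x)) = 2 * x := by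
    rw [← Real.sqrt_mul (by positivity),
      show x / (2 * Real.pi) * (4 * Real.pi * (2 * x)) = (2 * x) ^ 2 by
        field_simp
        ring,
      Real.sqrt_sq (by positivity)]
  have hexp : Real.exp (-(2 * x) / 2) = (Real.exp x)⁻¹ := by
    rw [← Real.exp_neg]
    ring_nf
  rw [gaussianOnSphere, alpha, alpha, hx, hn_eq, stirlingRatio, hexp,
    Real.mul_rpow two_pos.le Real.pi_pos.le, Real.mul_rpow two_pos.le hx_pos.le,
    Real.rpow_sub_one two_ne_zero, Real.rpow_sub_one hx_pos.ne']
  calc _ = Real.Gamma x / (Real.pi ^ x * (r ^ 2) ^ (x - 1)) *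
        ((√(x / (2 * Real.pi)) * √(4 * Real.pi * (2 * x))) / (2 * x)) := by field_simp
    _ = _ := by rw [hsqrt, div_self (by positivity), mul_one]

variable {k : ℕ} {f : EuclideanSpace ℝ (Fin k) → ℝ}

/-- The factor `(√(2k) / Σ) γ^{(km)}(r) α_{km}(km) / α_{km}(r²)` in front of the bracket in the
asymptotic formula for `Z_m(f, r)`. -/
noncomputable def leadingFactor (f : EuclideanSpace ℝ (Fin k) → ℝ) (m : ℕ) (r : ℝ) : ℝ :=
  √(2 * (k : ℝ)) / energyDev f * gaussianOnSphere (k * m) r *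
    (alpha (k * m) ((k : ℝ) * m) / alpha (k * m) (r ^ 2))

lemma leadingFactor_sqrt {m : ℕ} (hkm : 0 < (k : ℝ) * m) :
    leadingFactor f m √((k : ℝ) * m) =
      √(2 * (k : ℝ)) / energyDev f * gaussianOnSphere (k * m) √((k : ℝ) * m) := by
  rw [leadingFactor, Real.sq_sqrt hkm.le, div_self (alpha_pos _ hkm).ne', mul_one]

variable [NeZero k]

lemma leadingFactor_pos (hdev : 0 < energyDev f) (m : ℕ) [NeZero m] {r : ℝ} (hr : 0 < r) :
    0 < leadingFactor f m r := by
  have hk : (0 : ℝ) < k := by exact_mod_cast NeZero.pos k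
  have hm : (0 : ℝ) < m := by exact_mod_cast NeZero.pos m
  have hα := alpha_pos (k * m) (mul_pos hk hm)
  have hαr := alpha_pos (k * m) (pow_pos hr 2)
  unfold leadingFactor gaussianOnSphere
  positivity

lemma Z_eq_leadingFactor_mul (hf : IsProbDensity f) (hdev : 0 < energyDev f) (m : ℕ) [NeZero m]
    {r : ℝ} (hr : 0 < r) :
    Z f m r = leadingFactor f m r * (stirlingRatio (((k * m : ℕ) : ℝ) / 2) *
      (√(2 * Real.pi * (m * energyDev f ^ 2)) * (totalEnergyDensity f m (r ^ 2)).toReal)) := by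
  have hsqrt : √(4 * Real.pi * (k * m : ℕ)) =
      √(2 * (k : ℝ)) / energyDev f * √(2 * Real.pi * (m * energyDev f ^ 2)) := by
    rw [← mul_assoc (2 * Real.pi), Real.sqrt_mul (x := 2 * Real.pi * m) (by positivity),
      Real.sqrt_sq hdev.le, mul_comm √(2 * Real.pi * m), ← mul_assoc, div_mul_cancel₀ _ hdev.ne',
      ← Real.sqrt_mul (by positivity)]
    congr 1
    push_cast
    ring
  rw [Z_eq_totalEnergyDensity_mul hf.measurable hf.nonneg m hr,
    ← gaussianOnSphere_mul_alpha_div_alpha (mul_ne_zero (NeZero.ne k) (NeZero.ne m)) hr, hsqrt,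
    leadingFactor]
  push_cast
  ring

end LeadingFactor

section Asymptotics

variable {k : ℕ} [NeZero k] {Emax Smin p L ε : ℝ} {χ : ℝ → ℝ}

theorem eventually_totalEnergyDensity_approx (hSmin : 0 < Smin) (hp : 1 < p)
    (hχ : Tendsto χ (𝓝[>] (0 : ℝ)) (𝓝 0)) (hε : 0 < ε) :
    ∀ᶠ m : ℕ in atTop, ∀ f : EuclideanSpace ℝ (Fin k) → ℝ, IsAdmissible Emax Smin p L χ f →
      ∀ s : ℝ, totalEnergyDensity f m s ≠ ∞ ∧
        |√(2 * Real.pi * (m * energyDev f ^ 2)) * (totalEnergyDensity f m s).toReal -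
          Real.exp (-(s - m * energy f) ^ 2 / (2 * (m * energyDev f ^ 2)))| ≤ ε := by
  obtain ⟨C, N, hclass⟩ := exists_uniformLocalClass_centeredEnergyLaws
    (k := k) (Emax := Emax) (L := L) hSmin hp hχ
  obtain ⟨M, hNM, hM⟩ := hclass.exists_norm_sqrt_mul_inversionIntegral_sub_gaussian_le hε
  filter_upwards [eventually_ge_atTop (M + 2)] with m hm f hf s
  obtain ⟨j, rfl⟩ : ∃ j, m = j + 1 := ⟨m - 1, by omega⟩
  have : NeZero j := ⟨by omega⟩
  have hmem : centeredEnergyLaw f ∈ centeredEnergyLaws k Emax Smin p L χ := ⟨f, hf, rfl⟩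
  obtain ⟨hfin, hdensity⟩ := totalEnergyDensity_succ_eq_inversionIntegral hf.isProbDensity
    (hclass.integrable_charFun_pow hmem (by omega : N ≤ j)) s
  have hlimit := hM (j + 1) (by omega) _ hmem (s - (j + 1 : ℕ) * energy f)
  rw [hf.isProbDensity.integral_sq_centeredEnergyLaw, ← hdensity, ← Complex.ofReal_mul,
    ← Complex.ofReal_sub, Complex.norm_real, Real.norm_eq_abs] at hlimit
  exact ⟨hfin, hlimit⟩

theorem eventually_Z_div_leadingFactor_approx (hSmin : 0 < Smin) (hp : 1 < p)
    (hχ : Tendsto χ (𝓝[>] (0 : ℝ)) (𝓝 0)) (hε : 0 < ε) :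
    ∀ᶠ m : ℕ in atTop, ∀ f : EuclideanSpace ℝ (Fin k) → ℝ, IsAdmissible Emax Smin p L χ f →
      ∀ r : ℝ, 0 < r →
        Integrable (tensorPower f m) (sphereUniform (EuclideanSpace ℝ (Fin m × Fin k)) r) ∧
        |Z f m r / leadingFactor f m r -
          Real.exp (-(r ^ 2 - m * energy f) ^ 2 / (2 * m * energyDev f ^ 2))| ≤ ε := by
  have hstirling : Tendsto (fun m : ℕ => stirlingRatio (((k * m : ℕ) : ℝ) / 2)) atTop (𝓝 1) :=
    tendsto_stirlingRatio_half.comp (tendsto_id.const_mul_atTop' (NeZero.pos k))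
  have hratio {η : ℝ} (hη : 0 < η) :
      ∀ᶠ m : ℕ in atTop, |stirlingRatio (((k * m : ℕ) : ℝ) / 2) - 1| ≤ η :=
    (Metric.tendsto_nhds.1 hstirling η hη).mono fun m hm => hm.le
  filter_upwards [eventually_ne_atTop 0, hratio one_pos, hratio (half_pos hε),
    eventually_totalEnergyDensity_approx (k := k) (Emax := Emax) (L := L) hSmin hp hχ
      (show 0 < ε / 4 by positivity)] with m hm hratio_one hratio_half happrox f hf r hr
  have : NeZero m := ⟨hm⟩
  have hdev : 0 < energyDev f := hSmin.trans_le hf.le_energyDev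
  obtain ⟨hfin, hdensity⟩ := happrox f hf (r ^ 2)
  refine ⟨integrable_tensorPower hf.isProbDensity.measurable hf.isProbDensity.nonneg m hr hfin, ?_⟩
  rw [Z_eq_leadingFactor_mul hf.isProbDensity hdev m hr,
    mul_div_cancel_left₀ _ (leadingFactor_pos hdev m hr).ne', mul_assoc 2 (m : ℝ)]
  refine abs_mul_sub_le_of_abs_sub_one_le hratio_one hratio_half hdensity ?_
  rw [Real.abs_exp, Real.exp_le_one_iff, neg_div]
  exact neg_nonpos.2 (by positivity)

theorem exists_modulus_Z_eq_leadingFactor_mul (hSmin : 0 < Smin) (hp : 1 < p)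
    (hχ : Tendsto χ (𝓝[>] (0 : ℝ)) (𝓝 0)) :
    ∃ ω : ℕ → ℝ, Tendsto ω atTop (𝓝 0) ∧ ∀ᶠ m : ℕ in atTop,
      ∀ f : EuclideanSpace ℝ (Fin k) → ℝ, IsAdmissible Emax Smin p L χ f → ∀ r : ℝ, 0 < r →
        Integrable (tensorPower f m) (sphereUniform (EuclideanSpace ℝ (Fin m × Fin k)) r) ∧
        ∃ ε : ℝ, |ε| ≤ ω m ∧ Z f m r = leadingFactor f m r *
          (Real.exp (-(r ^ 2 - m * energy f) ^ 2 / (2 * m * energyDev f ^ 2)) + ε) := by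
  have happrox {ε : ℝ} (hε : 0 < ε) := eventually_Z_div_leadingFactor_approx
    (k := k) (Emax := Emax) (L := L) hSmin hp hχ hε
  obtain ⟨ω, hω, hω_bound⟩ := exists_tendsto_zero_of_eventually_abs_le
    (ι := {f : EuclideanSpace ℝ (Fin k) → ℝ // IsAdmissible Emax Smin p L χ f} × Set.Ioi (0 : ℝ))
    (fun m ⟨f, r⟩ => Z f.1 m r / leadingFactor f.1 m r -
      Real.exp (-((r : ℝ) ^ 2 - m * energy f.1) ^ 2 / (2 * m * energyDev f.1 ^ 2)))
    fun ε hε => (happrox hε).mono fun m hm ⟨f, r⟩ => (hm f.1 f.2 r r.2).2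
  refine ⟨ω, hω, ?_⟩
  filter_upwards [eventually_ne_atTop 0, hω_bound, happrox one_pos] with m hm hbound hone f hf r hr
  have : NeZero m := ⟨hm⟩
  refine ⟨(hone f hf r hr).1, _, hbound (⟨f, hf⟩, ⟨r, hr⟩), ?_⟩
  rw [add_sub_cancel,
    mul_div_cancel₀ _ (leadingFactor_pos (hSmin.trans_le hf.le_energyDev) m hr).ne']

end Asymptotics

end Kac

theorem mainTheorem10
    (k : ℕ) (hk : 1 ≤ k) (Emin Emax Smin p L : ℝ) (χ : ℝ → ℝ)
    (hEmin : 0 < Emin) (hSmin : 0 < Smin) (hp : 1 < p)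
    (hχ_nonneg : ∀ s : ℝ, 0 < s → 0 ≤ χ s)
    (hχ_lim : Tendsto χ (𝓝[>] (0 : ℝ)) (𝓝 0)) :
    ∃ (ω : ℕ → ℝ) (M : ℕ), Tendsto ω atTop (𝓝 0) ∧
      ∀ f : EuclideanSpace ℝ (Fin k) → ℝ,
        Kac.IsProbDensity f →
        Integrable (fun v => ‖v‖ ^ 4 * f v) →
        MemLp f (ENNReal.ofReal p) →
        Emin ≤ Kac.energy f → Kac.energy f ≤ Emax →
        Smin ≤ Kac.energyDev f →
        eLpNorm f (ENNReal.ofReal p) volume ≤ ENNReal.ofReal L →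
        (∀ s : ℝ, 0 < s → ∫ v in {v | 1 / s ≤ ‖v‖}, ‖v‖ ^ 4 * f v ≤ χ s) →
        ∀ m : ℕ, M ≤ m →
          (∀ r : ℝ, 0 < r →
            Integrable (Kac.tensorPower f m)
              (Kac.sphereUniform (EuclideanSpace ℝ (Fin m × Fin k)) r) ∧
            ∃ ε : ℝ, |ε| ≤ ω m ∧
              Kac.Z f m r =
                Real.sqrt (2 * (k : ℝ)) / Kac.energyDev f * Kac.gaussianOnSphere (k * m) r *
                  (Kac.alpha (k * m) ((k : ℝ) * m) / Kac.alpha (k * m) (r ^ 2)) *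
                  (Real.exp (-((r ^ 2 - m * Kac.energy f) ^ 2) /
                      (2 * m * Kac.energyDev f ^ 2)) + ε)) ∧
          (∃ ε : ℝ, |ε| ≤ ω m ∧
            Kac.Z f m (Real.sqrt ((k : ℝ) * m)) =
              Real.sqrt (2 * (k : ℝ)) / Kac.energyDev f *
                Kac.gaussianOnSphere (k * m) (Real.sqrt ((k : ℝ) * m)) *
                (Real.exp (-(m * ((k : ℝ) - Kac.energy f) ^ 2) /
                    (2 * Kac.energyDev f ^ 2)) + ε)) := by
  have : NeZero k := ⟨by omega⟩
  obtain ⟨ω, hω, hZ⟩ := Kac.exists_modulus_Z_eq_leadingFactor_mul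
    (k := k) (Emax := Emax) (L := L) hSmin hp hχ_lim
  obtain ⟨M, hM⟩ := eventually_atTop.1 hZ
  refine ⟨ω, max M 1, hω, fun f hf hfourth _ _ hE hdev hL htail m hm => ?_⟩
  have hkm : 0 < (k : ℝ) * m := by
    have : 0 < m := (le_max_right _ _).trans hm
    positivity
  have hall := hM m ((le_max_left _ _).trans hm) f ⟨hf, hfourth, hE, hdev, hL, htail⟩
  refine ⟨hall, ?_⟩
  obtain ⟨-, ε, hε, hZ_sqrt⟩ := hall _ (Real.sqrt_pos.2 hkm)
  refine ⟨ε, hε, ?_⟩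
  rw [hZ_sqrt, Kac.leadingFactor_sqrt hkm, Real.sq_sqrt hkm.le]
  congr 3
  field_simp
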